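/- **Problem.** Consider $$\min_{x\in\mathbb R^n} F(x):=f(x)+g(x)+h_1(A_1x)\quad\text{s.t. } A_2x\in\mathcal K ,$$ with optimal value $F^\star$, where $A_i\in\mathbb R^{d_i\times n}$; $g:\mathbb R^n\to\mathbb R\cup\{+\infty\}$ is proper, closed and $\mu_g$-strongly convex with $\mu_g\ge 0$ ($\mu_g=0$ meaning convex); $h_1:\mathbb R^{d_1}\to\mathbb R$ is convex and $L_{h_1}$-Lipschitz; $\mathcal K\subset\mathbb R^{d_2}$ is nonempty, closed and convex; $f:\mathbb R^n\to\mathbb R\cup\{+\infty\}$ is convex, differentiable on an open set containing $\mathrm{dom}(g)$, and for some $L>0$ satisfies $f(y)-f(x)-\langle\nabla f(x),y-x\rangle\le\frac L2\|x-y\|^2$ for all $x,y\in\mathrm{dom}(g)$. Put $A=(A_1;A_2)$ with spectral norm $\|A\|$, $d=d_1+d_2$, $h(u_1;u_2)=h_1(u_1)+\delta_{\mathcal K}(u_2)$ with $\delta_{\mathcal K}$ the indicator function of $\mathcal K$, and write $\lambda=(\lambda_1;\lambda_2)\in\mathbb R^{d}$. Assume strong duality: there are $x^\star\in\mathrm{dom}(g)$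 with $A_2x^\star\in\mathcal K$ and $\lambda^\star\in\mathrm{dom}(h^*)$ with $F(x^\star)=\mathcal L(x^\star;\lambda^\star)=\inf_x \mathcal L(x;\lambda^\star)$, where $\mathcal L(x;\lambda)=f(x)+g(x)+\langle\lambda,Ax\rangle-h^*(\lambda)$. For $\beta>0$ let $h(u;\lambda,\beta)$ and $\Lambda(u;\lambda,\beta)$ be the maximum value and the maximizer of $v\mapsto\langle v,u\rangle-h^*(v)-\frac\beta2\|v-\lambda\|^2$. **Inner solver (APG with restart).** For $\min\phi+P$ with smoothness constant $M$, APG sets $z^0=x^0$, $\theta_0=1$ and iterates $y^k=(1-\theta_k)x^k+\theta_kz^k$, $z^{k+1}=\arg\min_w\langle\nabla\phi(y^k),w-y^k\rangle+P(w)+\frac{\theta_kM}2\|w-z^k\|^2$, $x^{k+1}=(1-\theta_k)x^k+\theta_kz^{k+1}$, $\theta_{k+1}=\frac12\big(\sqrt{\theta_k^4+4\theta_k^2}-\theta_k^2\big)$. At stage $s$ it is applied to $H_s=\phi_s+P_s$ with $\phi_s(x)=f(x)+h(Ax;\lambda^s,\beta_s)$, $P_s(x)=g(x)+\frac{\beta_s}2\|x-x^{s-1}\|^2$,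 $M=L+\|A\|^2/\beta_s$, and is restarted (at the current $x$-iterate) every $K_s=\Big\lceil 2\sqrt{2(L+\|A\|^2/\beta_s)/(\mu_g+\beta_s)}\Big\rceil$ iterations. **Outer method (IPALM).** Take $\beta_0>0$, $\rho\in(\frac12,1)$, $0<\eta<\rho$, an integer $m_0\ge1$, $x^{-1}\in\mathrm{dom}(g)$, $\lambda^0\in\mathrm{dom}(h^*)$; let $\beta_s=\beta_0\rho^s$, $\epsilon_s=\epsilon_0\eta^s$. Let $x^0$ be the output of $m_0$ APG iterations on $H_0$ from $x^{-1}$, and let $\epsilon_0>0$ satisfy $\epsilon_0\ge H_0(x^0)-\min H_0$. For $s\ge0$ set $\lambda^{s+1}=\Lambda(Ax^s;\lambda^s,\beta_s)$, let $m_{s+1}$ be the smallest positive integer $m$ with $$2\epsilon_s+\beta_s\|\lambda^{s+1}-\lambda^s\|^2+\tfrac{\beta_s-\beta_{s+1}}2\|\Lambda(Ax^s;\lambda^{s+1},\beta_{s+1})-\lambda^{s+1}\|^2+\tfrac{\beta_s^2}{2\beta_{s+1}-\beta_s}\|x^{s-1}-x^s\|^2$$ $$+\|\lambda^{s+1}-\lambda^s\|\sqrt{\big((\beta_s+\beta_{s+1})L_{h_1}+\|\beta_s\lambda^s_1-\beta_{s+1}\lambda_1^{s+1}\|\big)^2+\|\beta_s\lambda_2^s-\beta_{s+1}\lambda_2^{s+1}\|^2}\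 \le\ 2^{\lfloor m/K_{s+1}\rfloor}\,\epsilon_{s+1}/2,$$ and let $x^{s+1}$ be the output of $m_{s+1}$ APG iterations on $H_{s+1}$ from $x^s$. **Constants.** Let $$c_0=2\Big(\sqrt{\|x^{-1}-x^\star\|^2+\|\lambda^0-\lambda^\star\|^2}+\tfrac{2\sqrt{\epsilon_0/\beta_0}}{1-\sqrt{\eta/\rho}}\Big)^2+2\|\lambda^\star\|^2+2\|x^\star\|^2,$$ $$c_1=\max\big(\epsilon_0+2L_{h_1}^2\beta_0+c_0\beta_0,\ \beta_0\|\lambda_2^\star\|\sqrt{c_0},\ \beta_0\sqrt{c_0}\big),$$ $$c_2=\log_2\Big(\tfrac4\eta+\tfrac{2\beta_0\left((11+2\rho^{-2})(L_{h_1}^2+4c_0)+4(2\rho-1)^{-1}c_0\right)}{\epsilon_0\eta}\Big)+1 .$$ **Claim.** There is $C$, a function of $c_1,c_2,\rho,\eta,\beta_0,\epsilon_0,m_0$ only, such that for every problem and run as above and every $0<\epsilon\le\epsilon_0$ there is $s\ge 0$ with $x^s\in\mathrm{dom}(g)$, $|F(x^s)-F^\star|\le\epsilon$, $\mathrm{dist}(A_2x^s,\mathcal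 K)\le\epsilon$, for which the total number of APG iterations satisfies $$\sum_{t=0}^s m_t\le C\,\frac{\sqrt{L\beta_0+\|A\|^2}+\sqrt{\mu_g}}{\sqrt{\mu_g\epsilon}}\,\ln\frac{c_1}{\epsilon\rho}\quad\text{if }\mu_g>0,$$ $$\sum_{t=0}^s m_t\le C\,\max\Big\{1,\frac{\sqrt{L\beta_0+\|A\|^2}}{\epsilon}\Big\}\,\ln^2\frac{c_1}{\epsilon\rho}\quad\text{if }\mu_g=0 .$$ That is, $\tilde O\big((\sqrt{L\beta_0+\|A\|^2}+\sqrt{\mu_g})/\sqrt{\mu_g\epsilon}\big)$ iterations if $\mu_g>0$, and $\tilde O\big(\sqrt{L\beta_0+\|A\|^2}/\epsilon\big)$ iterations if $\mu_g=0$ (as soon as $\epsilon\le\sqrt{L\beta_0+\|A\|^2}$). -/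

import Mathlib

open scoped InnerProductSpace

noncomputable section

namespace IPALM

/-- `ℝⁿ` with the Euclidean norm. -/
abbrev Primal (n : ℕ) := EuclideanSpace ℝ (Fin n)

/-- `ℝ^{d₁+d₂}`: pairs `(λ₁; λ₂)` with the Euclidean norm of the concatenated vector. -/
abbrev Dual (d₁ d₂ : ℕ) := WithLp 2 (EuclideanSpace ℝ (Fin d₁) × EuclideanSpace ℝ (Fin d₂))

/-- Effective domain of a function with values in `ℝ ∪ {+∞}`. -/
def effDom {V : Type*} (φ : V → EReal) : Set V := {x | φ x < ⊤}

/-- A minimiser of `φ` (arbitrary if there is none). -/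
def argmin {V : Type*} [Nonempty V] (φ : V → EReal) : V :=
  Classical.epsilon fun z => ∀ w, φ z ≤ φ w

/-- A maximiser of `φ` (arbitrary if there is none). -/
def argmax {V : Type*} [Nonempty V] (φ : V → EReal) : V :=
  Classical.epsilon fun z => ∀ w, φ w ≤ φ z

/-! ### The accelerated proximal gradient method -/

/-- State of the accelerated proximal gradient method: main iterate `x`, prox centre `z`,
step parameter `θ`. -/
structure APGState (n : ℕ) where
  x : Primal n
  z : Primal n
  θ : ℝ

/-- One iteration of the accelerated proximal gradient method for `min φ + P`, where `M` is the
smoothness constant of `φ`: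
`y = (1-θ) x + θ z`, `z⁺ = argmin_w ⟨∇φ(y), w - y⟩ + P(w) + (θ M / 2) ‖w - z‖²`,
`x⁺ = (1-θ) x + θ z⁺`, `θ⁺ = (√(θ⁴ + 4 θ²) - θ²) / 2`. -/
def apgStep {n : ℕ} (φ : Primal n → ℝ) (P : Primal n → EReal) (M : ℝ) (S : APGState n) :
    APGState n :=
  let y : Primal n := (1 - S.θ) • S.x + S.θ • S.z
  let z' : Primal n := argmin fun w =>
    ((⟪gradient φ y, w - y⟫_ℝ : ℝ) : EReal) + P w + ((S.θ * M / 2 * ‖w - S.z‖ ^ 2 : ℝ) : EReal)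
  { x := (1 - S.θ) • S.x + S.θ • z'
    z := z'
    θ := (√(S.θ ^ 4 + 4 * S.θ ^ 2) - S.θ ^ 2) / 2 }

/-- `k` iterations of the accelerated proximal gradient method from `x` (without restart). -/
def apg {n : ℕ} (φ : Primal n → ℝ) (P : Primal n → EReal) (M : ℝ) (k : ℕ) (x : Primal n) :
    Primal n :=
  ((apgStep φ P M)^[k] ⟨x, x, 1⟩).x

/-- `k` iterations from `x` of the accelerated proximal gradient method restarted every `N`
iterations. -/
def restartedAPG {n : ℕ} (φ : Primal n → ℝ) (P : Primal n → EReal) (M : ℝ) (N k : ℕ)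
    (x : Primal n) : Primal n :=
  apg φ P M (k % N) ((apg φ P M N)^[k / N] x)

/-! ### The optimization problem -/

/-- Data of `min f(x) + g(x) + h₁(A₁ x)` subject to `A₂ x ∈ K`, with the Lipschitz constant `Lh`
of `h₁`, the smoothness constant `L` of `f` and the strong convexity parameter `μ` of `g`. -/
structure Problem (n d₁ d₂ : ℕ) where
  f : Primal n → EReal
  g : Primal n → EReal
  h₁ : EuclideanSpace ℝ (Fin d₁) → ℝ
  K : Set (EuclideanSpace ℝ (Fin d₂))
  A₁ : Primal n →L[ℝ] EuclideanSpace ℝ (Fin d₁)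
  A₂ : Primal n →L[ℝ] EuclideanSpace ℝ (Fin d₂)
  Lh : ℝ
  L : ℝ
  μ : ℝ

namespace Problem

variable {n d₁ d₂ : ℕ} (p : Problem n d₁ d₂)

/-- Standing assumptions on the data. -/
structure Admissible : Prop where
  f_ne_bot : ∀ x, p.f x ≠ ⊥
  f_convex : ConvexOn ℝ (effDom p.f) fun x => (p.f x).toReal
  f_diff : ∃ U : Set (Primal n), IsOpen U ∧ effDom p.g ⊆ U ∧ U ⊆ effDom p.f ∧
    DifferentiableOn ℝ (fun x => (p.f x).toReal) U
  g_ne_bot : ∀ x, p.g x ≠ ⊥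
  g_proper : (effDom p.g).Nonempty
  g_closed : LowerSemicontinuous p.g
  μ_nonneg : 0 ≤ p.μ
  g_convex : StrongConvexOn (effDom p.g) p.μ fun x => (p.g x).toReal
  h₁_convex : ConvexOn ℝ Set.univ p.h₁
  Lh_nonneg : 0 ≤ p.Lh
  h₁_lipschitz : ∀ u v, |p.h₁ u - p.h₁ v| ≤ p.Lh * ‖u - v‖
  K_nonempty : p.K.Nonempty
  K_closed : IsClosed p.K
  K_convex : Convex ℝ p.K
  L_pos : 0 < p.L
  f_smooth : ∀ x ∈ effDom p.g, ∀ y ∈ effDom p.g,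
    (p.f y).toReal - (p.f x).toReal - ⟪gradient (fun x => (p.f x).toReal) x, y - x⟫_ℝ
      ≤ p.L / 2 * ‖x - y‖ ^ 2

/-- The stacked operator `A = (A₁; A₂)`. -/
def A : Primal n →L[ℝ] Dual d₁ d₂ :=
  ((WithLp.prodContinuousLinearEquiv 2 ℝ (EuclideanSpace ℝ (Fin d₁))
    (EuclideanSpace ℝ (Fin d₂))).symm : _ →L[ℝ] Dual d₁ d₂).comp (p.A₁.prod p.A₂)

open Classical in
/-- `h(u₁; u₂) = h₁(u₁) + (indicator function of K)(u₂)`. -/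
def h (u : Dual d₁ d₂) : EReal :=
  (p.h₁ u.fst : EReal) + if u.snd ∈ p.K then 0 else ⊤

/-- The Fenchel conjugate `h*`. -/
def hConj (v : Dual d₁ d₂) : EReal :=
  ⨆ u : Dual d₁ d₂, ((⟪v, u⟫_ℝ : ℝ) : EReal) - p.h u

/-- `⟨v, u⟩ - h*(v) - (β/2) ‖v - lam‖²`. -/
def smoothObj (u lam : Dual d₁ d₂) (β : ℝ) (v : Dual d₁ d₂) : EReal :=
  ((⟪v, u⟫_ℝ : ℝ) : EReal) - p.hConj v - ((β / 2 * ‖v - lam‖ ^ 2 : ℝ) : EReal)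

/-- The smoothed function `h(u; lam, β)`. -/
def hSmooth (u lam : Dual d₁ d₂) (β : ℝ) : EReal :=
  ⨆ v, p.smoothObj u lam β v

/-- The maximiser `Λ(u; lam, β)`. -/
def Lam (u lam : Dual d₁ d₂) (β : ℝ) : Dual d₁ d₂ :=
  argmax (p.smoothObj u lam β)

/-- The objective `F(x) = f(x) + g(x) + h₁(A₁ x)`. -/
def F (x : Primal n) : EReal := p.f x + p.g x + (p.h₁ (p.A₁ x) : EReal)

/-- The optimal value of the constrained problem. -/
def FStar : EReal := ⨅ x ∈ {x : Primal n | p.A₂ x ∈ p.K}, p.F x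

/-- The Lagrangian `f(x) + g(x) + ⟨lam, A x⟩ - h*(lam)`. -/
def lagrangian (x : Primal n) (lam : Dual d₁ d₂) : EReal :=
  p.f x + p.g x + ((⟪lam, p.A x⟫_ℝ : ℝ) : EReal) - p.hConj lam

/-- The dual function. -/
def dualFn (lam : Dual d₁ d₂) : EReal := ⨅ x, p.lagrangian x lam

/-- `xs` and `ls` are primal and dual optimal solutions and strong duality holds. -/
structure IsOptimalPair (xs : Primal n) (ls : Dual d₁ d₂) : Prop where
  primal_dom : xs ∈ effDom p.g
  dual_dom : ls ∈ effDom p.hConj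
  feasible : p.A₂ xs ∈ p.K
  primal_eq : p.F xs = p.lagrangian xs ls
  dual_eq : p.lagrangian xs ls = p.dualFn ls

/-- `x ∈ dom g` with `|F(x) - F*| ≤ ε` and `dist(A₂ x, K) ≤ ε`. -/
def IsEpsSolution (ε : ℝ) (x : Primal n) : Prop :=
  x ∈ effDom p.g ∧ p.F x ≤ p.FStar + (ε : EReal) ∧ p.FStar ≤ p.F x + (ε : EReal) ∧
    Metric.infDist (p.A₂ x) p.K ≤ ε

/-! ### Inner problems and inner solver -/

/-- The objective `H(x) = f(x) + g(x) + h(A x; lam, β) + (β/2) ‖x - y‖²` of the inner problem. -/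
def H (y : Primal n) (lam : Dual d₁ d₂) (β : ℝ) (x : Primal n) : EReal :=
  p.f x + p.g x + p.hSmooth (p.A x) lam β + ((β / 2 * ‖x - y‖ ^ 2 : ℝ) : EReal)

/-- The smooth part `f(x) + h(A x; lam, β)` of the inner objective. -/
def φ (lam : Dual d₁ d₂) (β : ℝ) (x : Primal n) : ℝ :=
  (p.f x).toReal + (p.hSmooth (p.A x) lam β).toReal

/-- The proximable part `g(x) + (β/2) ‖x - y‖²` of the inner objective. -/
def P (y : Primal n) (β : ℝ) (x : Primal n) : EReal :=
  p.g x + ((β / 2 * ‖x - y‖ ^ 2 : ℝ) : EReal)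

/-- The smoothness constant `L + ‖A‖² / β` of the smooth part of the inner objective. -/
def M (β : ℝ) : ℝ := p.L + ‖p.A‖ ^ 2 / β

/-- The number of iterations after which the inner solver has halved the optimality gap, which is
also its restart period. -/
def N (β : ℝ) : ℕ := ⌈2 * √(2 * p.M β / (p.μ + β))⌉₊

/-- The output of `k` iterations of the inner solver on `min H(·; y, lam, β)` started at `x`. -/
def innerSolver (y : Primal n) (lam : Dual d₁ d₂) (β : ℝ) (k : ℕ) (x : Primal n) : Primal n :=
  restartedAPG (p.φ lam β) (p.P y β) (p.M β) (p.N β) k x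

end Problem

/-! ### The outer method -/

/-- Parameters and starting points of the outer method; `xInit` is `x⁻¹`. -/
structure Params (n d₁ d₂ : ℕ) where
  β₀ : ℝ
  ρ : ℝ
  η : ℝ
  ε₀ : ℝ
  m₀ : ℕ
  xInit : Primal n
  lamInit : Dual d₁ d₂

/-- State of the outer method at stage `s`: `x^{s-1}`, `x^s`, `λ^s` and the number `m_s` of inner
iterations used to compute `x^s`. -/
structure State (n d₁ d₂ : ℕ) where
  xPrev : Primal n
  x : Primal n
  lam : Dual d₁ d₂
  m : ℕ

variable {n d₁ d₂ : ℕ} (p : Problem n d₁ d₂) (q : Params n d₁ d₂)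

/-- `β_s = β₀ ρ^s`. -/
def Params.β (s : ℕ) : ℝ := q.β₀ * q.ρ ^ s

/-- `ε_s = ε₀ η^s`. -/
def Params.ε (s : ℕ) : ℝ := q.ε₀ * q.η ^ s

/-- The inner termination test for `m_{s+1} = m`, where `xp = x^{s-1}`, `x = x^s`, `lam = λ^s`,
`lam' = λ^{s+1}`. -/
def EnoughInner (s : ℕ) (xp x : Primal n) (lam lam' : Dual d₁ d₂) (m : ℕ) : Prop :=
  2 * q.ε s + q.β s * ‖lam' - lam‖ ^ 2
    + (q.β s - q.β (s + 1)) / 2 * ‖p.Lam (p.A x) lam' (q.β (s + 1)) - lam'‖ ^ 2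
    + q.β s ^ 2 / (2 * q.β (s + 1) - q.β s) * ‖xp - x‖ ^ 2
    + ‖lam' - lam‖ * √(((q.β s + q.β (s + 1)) * p.Lh
          + ‖q.β s • lam.fst - q.β (s + 1) • lam'.fst‖) ^ 2
        + ‖q.β s • lam.snd - q.β (s + 1) • lam'.snd‖ ^ 2)
  ≤ 2 ^ (m / p.N (q.β (s + 1))) * (q.ε (s + 1) / 2)

/-- The method: `x⁰` is the result of `m₀` inner iterations from `x⁻¹`; then
`λ^{s+1} = Λ(A x^s; λ^s, β_s)`, `m_{s+1}` is the smallest positive integer passing the termination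
test, and `x^{s+1}` is the result of `m_{s+1}` inner iterations on `H_{s+1}` from `x^s`. -/
def run : ℕ → State n d₁ d₂
  | 0 =>
    { xPrev := q.xInit
      x := p.innerSolver q.xInit q.lamInit (q.β 0) q.m₀ q.xInit
      lam := q.lamInit
      m := q.m₀ }
  | s + 1 =>
    let S := run s
    let lam' := p.Lam (p.A S.x) S.lam (q.β s)
    let m' := sInf {m : ℕ | 0 < m ∧ EnoughInner p q s S.xPrev S.x S.lam lam' m}
    { xPrev := S.x
      x := p.innerSolver S.x lam' (q.β (s + 1)) m' S.x
      lam := lam'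
      m := m' }

/-- Requirements on the parameters and the starting points. -/
structure Params.Valid : Prop where
  β₀_pos : 0 < q.β₀
  ρ_gt : 1 / 2 < q.ρ
  ρ_lt : q.ρ < 1
  η_pos : 0 < q.η
  η_lt : q.η < q.ρ
  m₀_pos : 0 < q.m₀
  ε₀_pos : 0 < q.ε₀
  xInit_dom : q.xInit ∈ effDom p.g
  lamInit_dom : q.lamInit ∈ effDom p.hConj
  /-- `ε₀ ≥ H₀(x⁰) - H₀*`. -/
  ε₀_ge : p.H q.xInit q.lamInit (q.β 0) (run p q 0).x
    ≤ (⨅ x, p.H q.xInit q.lamInit (q.β 0) x) + (q.ε₀ : EReal)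

/-! ### The solver independent constants -/

def c₀ (xs : Primal n) (ls : Dual d₁ d₂) : ℝ :=
  2 * (√(‖q.xInit - xs‖ ^ 2 + ‖q.lamInit - ls‖ ^ 2)
      + 2 * √(q.ε₀ / q.β₀) / (1 - √(q.η / q.ρ))) ^ 2
    + 2 * ‖ls‖ ^ 2 + 2 * ‖xs‖ ^ 2

def c₁ (xs : Primal n) (ls : Dual d₁ d₂) : ℝ :=
  max (q.ε₀ + 2 * p.Lh ^ 2 * q.β₀ + c₀ q xs ls * q.β₀)
    (max (q.β₀ * ‖ls.snd‖ * √(c₀ q xs ls)) (q.β₀ * √(c₀ q xs ls)))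

def c₂ (xs : Primal n) (ls : Dual d₁ d₂) : ℝ :=
  Real.logb 2 (4 / q.η
    + 2 * q.β₀ * ((11 + 2 / q.ρ ^ 2) * (p.Lh ^ 2 + 4 * c₀ q xs ls)
        + 4 / (2 * q.ρ - 1) * c₀ q xs ls) / (q.ε₀ * q.η)) + 1

end IPALM

end

noncomputable section
namespace IPALM

/-! ### Generic convex analysis -/

section Generic

variable {E : Type*} [NormedAddCommGroup E] [InnerProductSpace ℝ E]

/-! An outer stage is an inexact proximal point step for the saddle function `f + g + ⟨λ, A x⟩ -
h*(λ)`: the exact minimiser of `H_s` and its multiplier form the primal-dual proximal point of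
`(x^{s-1}, λ^s)`. Such a step does not increase the distance to a saddle point
(`prox_nonexpansive`), and joint quadratic growth (`HR_growth`) turns the inner gap `ε_s` into an
error of at most `√(2 ε_s / β_s)`. Since `η < ρ`, these errors have a finite geometric sum, so
iterates and multipliers stay in a ball whose radius depends on `c₀` (`dist_saddle_le`).

Accuracy: the proximal point attached to `A x^s` lies in `dom h`, at distance `β_s ‖λ^{s+1} - λ^s‖`
from `A x^s`. Hence infeasibility and objective error are both `O(ρ^s)` (`isEpsSolution_run`).

Cost: `warm_start` bounds the initial gap of the next inner problem by part of the left side of the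
termination test, so the test guarantees the accuracy `ε_{s+1}` (`stageGap`). That left side is
`O(ρ^s)` by boundedness, the target is of order `η^{s+1}`, and a restart period halves the gap
(`apg_halve`). So the number of periods in a stage is at most affine in `s` (`run_m_succ_le`). With
`S = √(L β₀ + ‖A‖²)`, a period has length `O(1 + S / β_t)`, and also `O(1 + S / √(μ β_t))` if `μ >
0`; the growing parts sum geometrically and are dominated by the last stage.

Stop at the first `s` with `7 c₁ ρ^s ≤ ε`. Then `ρ^{-s}` is of order `c₁ / ε` and `s` is
logarithmic, which gives the powers `1/ε` and `1/√ε`. One logarithm counts the periods per stage;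
for `μ = 0` a second one counts the stages. -/

theorem nonneg_of_forall_add_mul {a b : ℝ} (h : ∀ t : ℝ, 0 < t → t < 1 → 0 ≤ a + t * b) :
    0 ≤ a := by
  have h1 : Filter.Tendsto (fun t : ℝ => a + t * b) (nhdsWithin 0 (Set.Ioi 0)) (nhds a) := by
    have : Filter.Tendsto (fun t : ℝ => a + t * b) (nhds 0) (nhds (a + 0 * b)) :=
      Continuous.tendsto (by fun_prop) 0
    rw [zero_mul, add_zero] at this
    exact this.mono_left nhdsWithin_le_nhds
  refine ge_of_tendsto h1 ?_
  filter_upwards [Ioo_mem_nhdsGT (show (0 : ℝ) < 1 by norm_num)] with t ht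
  exact h t ht.1 ht.2

theorem norm_add_smul_sq (x y : E) (t : ℝ) :
    ‖x + t • y‖ ^ 2 = ‖x‖ ^ 2 + 2 * t * ⟪x, y⟫_ℝ + t ^ 2 * ‖y‖ ^ 2 := by
  rw [norm_add_sq_real, inner_smul_right, norm_smul, mul_pow, Real.norm_eq_abs, sq_abs]
  ring

theorem segment_eq (x y : E) (t : ℝ) : (1 - t) • x + t • y = x + t • (y - x) := by
  module

theorem StrongConvexOn.segment_le {s : Set E} {κ : ℝ} {Q : E → ℝ} (hQ : StrongConvexOn s κ Q)
    {x y : E} (hx : x ∈ s) (hy : y ∈ s) {t : ℝ} (h0 : 0 ≤ t) (h1 : t ≤ 1) :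
    Q (x + t • (y - x)) ≤ (1 - t) * Q x + t * Q y - (1 - t) * t * (κ / 2 * ‖x - y‖ ^ 2) := by
  have := hQ.2 hx hy (sub_nonneg.2 h1) h0 (by ring)
  rwa [segment_eq] at this

theorem segment_mem {s : Set E} (hs : Convex ℝ s) {x y : E} (hx : x ∈ s) (hy : y ∈ s) {t : ℝ}
    (h0 : 0 ≤ t) (h1 : t ≤ 1) : x + t • (y - x) ∈ s := by
  rw [← segment_eq]
  exact hs hx hy (sub_nonneg.2 h1) h0 (by ring)

theorem ConvexOn.segment_le {s : Set E} {Q : E → ℝ} (hQ : ConvexOn ℝ s Q)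
    {x y : E} (hx : x ∈ s) (hy : y ∈ s) {t : ℝ} (h0 : 0 ≤ t) (h1 : t ≤ 1) :
    Q (x + t • (y - x)) ≤ (1 - t) * Q x + t * Q y := by
  have := hQ.2 hx hy (sub_nonneg.2 h1) h0 (by ring)
  rwa [segment_eq] at this

/-- Quadratic growth of a strongly convex function at a minimiser. -/
theorem StrongConvexOn.quadratic_growth {s : Set E} {κ : ℝ} {Q : E → ℝ}
    (hQ : StrongConvexOn s κ Q) {z : E} (hz : z ∈ s) (hmin : ∀ w ∈ s, Q z ≤ Q w) {w : E}
    (hw : w ∈ s) : Q z + κ / 2 * ‖w - z‖ ^ 2 ≤ Q w := by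
  have : 0 ≤ (Q w - Q z - κ / 2 * ‖w - z‖ ^ 2) := by
    -- Minimality along the segment is divided by `t`, and the remainder vanishes as `t → 0`.
    -- First-order conditions below are obtained in the same way.
    refine nonneg_of_forall_add_mul (b := κ / 2 * ‖w - z‖ ^ 2) fun t h0 h1 => ?_
    have h2 := hmin _ (segment_mem hQ.1 hz hw h0.le h1.le)
    have h3 := StrongConvexOn.segment_le hQ hz hw h0.le h1.le
    rw [norm_sub_rev z w] at h3
    have h4 : 0 ≤ t * (Q w - Q z - κ / 2 * ‖w - z‖ ^ 2 + t * (κ / 2 * ‖w - z‖ ^ 2)) := by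
      linarith
    exact nonneg_of_mul_nonneg_right h4 h0
  linarith

theorem strongConvexOn_add_sq {s : Set E} {κ : ℝ} {Q : E → ℝ} (hQ : StrongConvexOn s κ Q)
    (c : ℝ) (y : E) : StrongConvexOn s (κ + c) fun x => Q x + c / 2 * ‖x - y‖ ^ 2 := by
  refine ⟨hQ.1, fun x hx w hw a b ha hb hab => ?_⟩
  have h := hQ.2 hx hw ha hb hab
  obtain rfl : a = 1 - b := by linarith
  have e1 : (1 - b) • x + b • w - y = (x - y) + b • (w - x) := by module
  have e2 : w - y = (x - y) + (1 : ℝ) • (w - x) := by module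
  simp only [smul_eq_mul] at h ⊢
  rw [e1, e2, norm_add_smul_sq, norm_add_smul_sq, norm_sub_rev x w]
  rw [norm_sub_rev x w] at h
  nlinarith

theorem strongConvexOn_add_affine {s : Set E} {κ : ℝ} {Q : E → ℝ} (hQ : StrongConvexOn s κ Q)
    (b y : E) : StrongConvexOn s κ fun x => ⟪b, x - y⟫_ℝ + Q x := by
  refine ⟨hQ.1, fun x hx w hw a c ha hc hac => ?_⟩
  have h := hQ.2 hx hw ha hc hac
  obtain rfl : a = 1 - c := by linarith
  have e1 : (1 - c) • x + c • w - y = (1 - c) • (x - y) + c • (w - y) := by module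
  simp only [smul_eq_mul] at h ⊢
  rw [e1, inner_add_right, inner_smul_right, inner_smul_right]
  linarith

theorem ConvexOn.add_strongConvexOn {s : Set E} {κ : ℝ} {P Q : E → ℝ} (hP : ConvexOn ℝ s P)
    (hQ : StrongConvexOn s κ Q) : StrongConvexOn s κ fun x => P x + Q x := by
  refine ⟨hQ.1, fun x hx w hw a b ha hb hab => ?_⟩
  have h := hQ.2 hx hw ha hb hab
  have h' := hP.2 hx hw ha hb hab
  simp only [smul_eq_mul] at h h' ⊢
  linarith

/-- Gradient inequality for a convex function at a point of differentiability. -/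
theorem ConvexOn.gradient_le [CompleteSpace E] {s : Set E} {f : E → ℝ} (hf : ConvexOn ℝ s f)
    {x y v : E} (hx : x ∈ s) (hy : y ∈ s) (hd : HasGradientAt f v x) :
    f x + ⟪v, y - x⟫_ℝ ≤ f y := by
  have h1 : HasDerivAt (fun t : ℝ => f (x + t • (y - x))) ⟪v, y - x⟫_ℝ 0 := by
    have h2 : HasDerivAt (fun t : ℝ => x + t • (y - x)) (y - x) 0 := by
      simpa using ((hasDerivAt_id (0 : ℝ)).smul_const (y - x)).const_add x
    have h3 := hd.hasFDerivAt
    have h4 : HasFDerivAt f ((InnerProductSpace.toDual ℝ E) v)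
        ((fun t : ℝ => x + t • (y - x)) 0) := by simpa using h3
    have h8 := h4.comp_hasDerivAt (0 : ℝ) h2
    rw [InnerProductSpace.toDual_apply_apply] at h8
    exact h8
  have h5 := h1.tendsto_slope_zero_right
  have h6 : ⟪v, y - x⟫_ℝ ≤ f y - f x := by
    refine le_of_tendsto h5 ?_
    filter_upwards [Ioo_mem_nhdsGT (show (0 : ℝ) < 1 by norm_num)] with t ht
    have h7 := ConvexOn.segment_le hf hx hy ht.1.le ht.2.le
    simp only [zero_add, zero_smul, add_zero, smul_eq_mul]
    rw [inv_mul_le_iff₀ ht.1]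
    linarith
  linarith

/-- A function squeezed between its linearisation and a quadratic is differentiable. -/
theorem hasGradientAt_of_sandwich [CompleteSpace E] {f : E → ℝ} {x v : E} {c : ℝ}
    (hl : ∀ y, f x + ⟪v, y - x⟫_ℝ ≤ f y)
    (hu : ∀ y, f y ≤ f x + ⟪v, y - x⟫_ℝ + c * ‖y - x‖ ^ 2) : HasGradientAt f v x := by
  rw [hasGradientAt_iff_isLittleO]
  have h1 : (fun y => f y - f x - ⟪v, y - x⟫_ℝ) =O[nhds x] fun y => ‖y - x‖ ^ 2 := by
    refine Asymptotics.IsBigO.of_bound c (Filter.Eventually.of_forall fun y => ?_)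
    rw [Real.norm_eq_abs, abs_le, Real.norm_eq_abs, abs_of_nonneg (sq_nonneg _)]
    have := hl y
    have := hu y
    constructor <;> linarith
  refine h1.trans_isLittleO ?_
  have h2 : (fun y => ‖y - x‖ ^ 2) =o[nhds x] fun y => ‖y - x‖ := by
    have h3 := (Asymptotics.isLittleO_pow_id (𝕜 := ℝ) (n := 2) (by norm_num))
    have h4 : Filter.Tendsto (fun y : E => ‖y - x‖) (nhds x) (nhds 0) := by
      have : Filter.Tendsto (fun y : E => ‖y - x‖) (nhds x) (nhds ‖x - x‖) :=
        Continuous.tendsto (by fun_prop) x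
      simpa using this
    exact h3.comp_tendsto h4
  exact h2.of_norm_right

/-- Existence of minimisers of strongly convex functions `g + ψ` on `dom g`. -/
theorem exists_min_add [FiniteDimensional ℝ E] {g : E → EReal} (hlsc : LowerSemicontinuous g)
    (hbot : ∀ x, g x ≠ ⊥) (hne : (effDom g).Nonempty) {ψ : E → ℝ}
    (hψ : ContinuousOn ψ (effDom g)) {c : ℝ} {b : E}
    (hψb : ∀ x ∈ effDom g, c + ⟪b, x⟫_ℝ ≤ ψ x) {κ : ℝ} (hκ : 0 < κ)
    (hsc : StrongConvexOn (effDom g) κ fun x => (g x).toReal + ψ x) :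
    ∃ z ∈ effDom g, ∀ w ∈ effDom g, (g z).toReal + ψ z ≤ (g w).toReal + ψ w := by
  have : ProperSpace E := FiniteDimensional.proper_real E
  obtain ⟨x₀, hx₀⟩ := hne
  set D := effDom g with hD
  set G : E → ℝ := fun x => (g x).toReal + ψ x with hG
  have hcoe : ∀ x ∈ D, g x = ((g x).toReal : EReal) := fun x hx =>
    (EReal.coe_toReal (ne_of_lt hx) (hbot x)).symm
  have hGlsc : LowerSemicontinuousOn G D := by
    refine LowerSemicontinuousOn.add ?_ hψ.lowerSemicontinuousOn
    intro x hx y hy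
    have h1 : ((y : ℝ) : EReal) < g x := by rw [hcoe x hx]; exact_mod_cast hy
    filter_upwards [nhdsWithin_le_nhds (hlsc x _ h1), self_mem_nhdsWithin] with x' h2 h3
    rw [hcoe x' h3] at h2
    exact_mod_cast h2
  -- The affine minorant of `ψ` gives a uniform lower bound on each unit ball. It serves twice: to
  -- keep limit points of the sublevel set inside `dom g`, and to bound `G` below near `x₀`.
  have haff : ∀ x₁ : E, ∀ x ∈ Metric.closedBall x₁ 1 ∩ D, c - ‖b‖ * (‖x₁‖ + 1) ≤ ψ x := by
    intro x₁ x hx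
    have h1 := hψb x hx.2
    have h2 := abs_le.1 (abs_real_inner_le_norm b x)
    have h3 : ‖x‖ ≤ ‖x₁‖ + 1 := by
      have := norm_le_norm_add_norm_sub' x x₁
      have h4 := hx.1
      rw [Metric.mem_closedBall, dist_eq_norm] at h4
      linarith
    have h5 := mul_le_mul_of_nonneg_left h3 (norm_nonneg b)
    linarith [h2.1]
  set S : Set E := {x | x ∈ D ∧ G x ≤ G x₀} with hS
  have hSne : S.Nonempty := ⟨x₀, hx₀, le_rfl⟩
  have hSclosed : IsClosed S := by
    refine isClosed_of_closure_subset fun x hx => ?_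
    rw [mem_closure_iff_frequently] at hx
    -- `dom g` need not be closed. If `g x = ⊤`, lower semicontinuity lifts `g` above `T` near `x`,
    -- too high for the nearby points of the sublevel set.
    have hxD : x ∈ D := by
      by_contra hcon
      have htop : g x = ⊤ := by
        by_contra h
        exact hcon (lt_top_iff_ne_top.2 h)
      set T : ℝ := G x₀ - (c - ‖b‖ * (‖x‖ + 1))
      have h1 : ((T : ℝ) : EReal) < g x := by rw [htop]; exact EReal.coe_lt_top _
      obtain ⟨y, hyS, hyT, hyb⟩ := (hx.and_eventually ((hlsc x _ h1).and
        (Metric.closedBall_mem_nhds x one_pos))).exists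
      rw [hcoe y hyS.1] at hyT
      have h2 : T < (g y).toReal := by exact_mod_cast hyT
      have h3 := haff x y ⟨hyb, hyS.1⟩
      have h4 : (g y).toReal + ψ y ≤ G x₀ := hyS.2
      simp only [T] at h2
      linarith
    refine ⟨hxD, ?_⟩
    by_contra hcon
    have h1 := hGlsc x hxD _ (not_le.1 hcon)
    rw [eventually_nhdsWithin_iff] at h1
    obtain ⟨y, hyS, hy⟩ := (hx.and_eventually h1).exists
    exact absurd hyS.2 (not_le.2 (hy hyS.1))
  obtain ⟨m, hm⟩ : ∃ m : ℝ, ∀ x ∈ Metric.closedBall x₀ 1 ∩ D, m ≤ G x := by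
    obtain ⟨x₁, hx₁, hmin⟩ := LowerSemicontinuousOn.exists_isMinOn
      (s := Metric.closedBall x₀ 1) ⟨x₀, Metric.mem_closedBall_self zero_le_one⟩
      (isCompact_closedBall x₀ 1) (hlsc.lowerSemicontinuousOn _)
    have h0 : g x₁ ≤ g x₀ := hmin (Metric.mem_closedBall_self zero_le_one)
    have hx₁D : x₁ ∈ D := lt_of_le_of_lt h0 hx₀
    refine ⟨(g x₁).toReal + (c - ‖b‖ * (‖x₀‖ + 1)), fun x hx => ?_⟩
    have h1 : g x₁ ≤ g x := hmin hx.1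
    rw [hcoe x hx.2, hcoe x₁ hx₁D] at h1
    have h2 : (g x₁).toReal ≤ (g x).toReal := by exact_mod_cast h1
    have h3 := haff x₀ x hx
    simp only [hG]
    linarith
  have hSbdd : S ⊆ Metric.closedBall x₀ (1 + 2 * (G x₀ - m) / κ) := by
    intro x hx
    rw [Metric.mem_closedBall, dist_eq_norm]
    have hm0 : m ≤ G x₀ := hm x₀ ⟨Metric.mem_closedBall_self zero_le_one, hx₀⟩
    by_cases ht : ‖x - x₀‖ ≤ 1
    · have : 0 ≤ 2 * (G x₀ - m) / κ := div_nonneg (by linarith) hκ.le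
      linarith
    -- The point of the segment at distance one from `x₀` has value at least `m`, but strong
    -- convexity makes it at most `G x₀ - (t - 1) κ / 2`.
    · have ht := not_le.1 ht
      set t := ‖x - x₀‖ with htdef
      have ht0 : 0 < t := by linarith
      have hi0 : 0 ≤ t⁻¹ := by positivity
      have hi1 : t⁻¹ ≤ 1 := inv_le_one_of_one_le₀ ht.le
      have h1 := StrongConvexOn.segment_le hsc hx₀ hx.1 hi0 hi1
      have h2 := hm (x₀ + t⁻¹ • (x - x₀)) ⟨by
        rw [Metric.mem_closedBall, dist_eq_norm, add_sub_cancel_left, norm_smul,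
          Real.norm_eq_abs, abs_of_nonneg hi0, ← htdef, inv_mul_cancel₀ ht0.ne'],
        segment_mem hsc.1 hx₀ hx.1 hi0 hi1⟩
      rw [norm_sub_rev x₀ x, ← htdef] at h1
      have h3 : (1 - t⁻¹) * t⁻¹ * (κ / 2 * t ^ 2) = (t - 1) * (κ / 2) := by
        field_simp
      have h4 : t⁻¹ * G x ≤ t⁻¹ * G x₀ := mul_le_mul_of_nonneg_left hx.2 hi0
      have h5 : m ≤ G x₀ - (t - 1) * (κ / 2) := by
        rw [h3] at h1
        simp only [hG] at h1 h2 h4 ⊢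
        linarith
      have h6 : (t - 1) ≤ 2 * (G x₀ - m) / κ := by
        rw [le_div_iff₀ hκ]
        linarith
      linarith
  obtain ⟨z, hz, hmin⟩ := LowerSemicontinuousOn.exists_isMinOn hSne
    ((isCompact_closedBall _ _).of_isClosed_subset hSclosed hSbdd)
    (hGlsc.mono fun x hx => hx.1)
  refine ⟨z, hz.1, fun w hw => ?_⟩
  by_cases h : G w ≤ G x₀
  · exact hmin (show w ∈ S from ⟨hw, h⟩)
  · exact hz.2.trans (not_le.1 h).le

end Generic

/-! ### The smoothed function and its maximiser -/

theorem lowerSemicontinuous_ite_top {V : Type*} [TopologicalSpace V] {s : Set V}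
    (hs : IsClosed s) [DecidablePred (· ∈ s)] :
    LowerSemicontinuous fun x => if x ∈ s then (0 : EReal) else ⊤ := by
  intro x y hy
  by_cases hx : x ∈ s
  · simp only [hx, if_true] at hy
    refine Filter.Eventually.of_forall fun x' => ?_
    show y < if x' ∈ s then (0 : EReal) else ⊤
    split_ifs
    · exact hy
    · exact hy.trans_le le_top
  · simp only [hx, if_false] at hy
    filter_upwards [hs.isOpen_compl.mem_nhds hx] with x' hx'
    have : x' ∉ s := hx'
    simp only [this, if_false]
    exact hy

namespace Problem

variable {n d₁ d₂ : ℕ} {p : Problem n d₁ d₂}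

/-- Real value of the conjugate. -/
def hc (p : Problem n d₁ d₂) (v : Dual d₁ d₂) : ℝ := (p.hConj v).toReal

/-- Real value of the smoothed function. -/
def hs (p : Problem n d₁ d₂) (u lam : Dual d₁ d₂) (β : ℝ) : ℝ := (p.hSmooth u lam β).toReal

/-- `z` is the proximal point of `β h` at `u + β lam` and `v` the corresponding subgradient
of `h` at `z`. -/
structure IsProx (p : Problem n d₁ d₂) (u lam : Dual d₁ d₂) (β : ℝ) (z v : Dual d₁ d₂) :
    Prop where
  mem : z.snd ∈ p.K
  eq : β • (v - lam) = u - z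
  sub : ∀ z' : Dual d₁ d₂, z'.snd ∈ p.K → p.h₁ z.fst + ⟪v, z' - z⟫_ℝ ≤ p.h₁ z'.fst

theorem norm_fst_le (z : Dual d₁ d₂) : ‖z.fst‖ ≤ ‖z‖ := by
  refine abs_le_of_sq_le_sq' ?_ (norm_nonneg _) |>.2
  rw [WithLp.prod_norm_sq_eq_of_L2 z]
  nlinarith [sq_nonneg ‖z.snd‖]

theorem norm_snd_le (z : Dual d₁ d₂) : ‖z.snd‖ ≤ ‖z‖ := by
  refine abs_le_of_sq_le_sq' ?_ (norm_nonneg _) |>.2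
  rw [WithLp.prod_norm_sq_eq_of_L2 z]
  nlinarith [sq_nonneg ‖z.fst‖]

theorem Admissible.h₁_continuous (hp : p.Admissible) : Continuous p.h₁ := by
  have : LipschitzWith ⟨p.Lh, hp.Lh_nonneg⟩ p.h₁ := by
    refine LipschitzWith.of_dist_le_mul fun u v => ?_
    rw [Real.dist_eq, dist_eq_norm]
    exact hp.h₁_lipschitz u v
  exact this.continuous

/-- The point `z` minimises `h(z) + ‖z - (u + β lam)‖² / (2 β)`, and the first-order condition makes
`lam + (u - z) / β` a subgradient of `h` at `z`. Existence for the dual maximisation is thus derived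
on the primal side. -/
theorem Admissible.exists_isProx (hp : p.Admissible) (u lam : Dual d₁ d₂) {β : ℝ} (hβ : 0 < β) :
    ∃ z v, p.IsProx u lam β z v := by
  classical
  set w : Dual d₁ d₂ := u + β • lam with hw
  let s : Set (Dual d₁ d₂) := {z | z.snd ∈ p.K}
  have hs : IsClosed s := hp.K_closed.preimage (WithLp.prod_continuous_ofLp 2 _ _ |>.snd)
  let g : Dual d₁ d₂ → EReal := fun x => if x ∈ s then (0 : EReal) else ⊤
  have hgs : effDom g = s := by
    ext x
    simp only [effDom, g, Set.mem_ofPred_eq]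
    split_ifs with h <;> simp [h]
  have hg0 : ∀ x, (g x).toReal = 0 := by
    intro x
    simp only [g]
    split_ifs <;> simp
  let ψ : Dual d₁ d₂ → ℝ := fun z => p.h₁ z.fst + β⁻¹ / 2 * ‖z - w‖ ^ 2
  have hsconv : Convex ℝ s := by
    intro x hx y hy a b ha hb hab
    exact hp.K_convex hx hy ha hb hab
  have hcv : ConvexOn ℝ s fun z : Dual d₁ d₂ => p.h₁ z.fst := by
    refine ⟨hsconv, fun x _ y _ a b ha hb hab => ?_⟩
    exact hp.h₁_convex.2 (Set.mem_univ _) (Set.mem_univ _) ha hb hab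
  have hstrong : StrongConvexOn s (0 + β⁻¹) ψ :=
    strongConvexOn_add_sq (strongConvexOn_zero.2 hcv) _ w
  have hβ' : 0 < β⁻¹ := inv_pos.2 hβ
  have hcont : Continuous ψ := by
    have h1 : Continuous fun z : Dual d₁ d₂ => z.fst := (WithLp.prod_continuous_ofLp 2 _ _).fst
    have h2 := hp.h₁_continuous.comp h1
    exact h2.add (by fun_prop)
  have hKne : s.Nonempty := by
    obtain ⟨k, hk⟩ := hp.K_nonempty
    exact ⟨WithLp.toLp 2 (0, k), hk⟩
  -- After the Lipschitz bound on `h₁`, the constant comes from completing the square in `‖x - w‖ -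
  -- Lh β`.
  have hbd : ∀ x ∈ effDom g, (p.h₁ 0 - p.Lh * ‖w‖ - p.Lh ^ 2 * β / 2)
      + ⟪(0 : Dual d₁ d₂), x⟫_ℝ ≤ ψ x := by
    intro x _
    have h1 := (abs_le.1 (hp.h₁_lipschitz x.fst 0)).1
    have h2 : ‖x.fst - 0‖ ≤ ‖x - w‖ + ‖w‖ := by
      rw [sub_zero]
      have := norm_le_norm_add_norm_sub' x w
      linarith [norm_fst_le x]
    have h3 := mul_le_mul_of_nonneg_left h2 hp.Lh_nonneg
    have h4 : 0 ≤ β⁻¹ / 2 * (‖x - w‖ - p.Lh * β) ^ 2 := by positivity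
    have h5 : β⁻¹ / 2 * (‖x - w‖ - p.Lh * β) ^ 2
        = β⁻¹ / 2 * ‖x - w‖ ^ 2 - p.Lh * ‖x - w‖ + p.Lh ^ 2 * β / 2 := by
      field_simp
      ring
    rw [inner_zero_left]
    simp only [ψ]
    linarith
  obtain ⟨z, hz, hmin⟩ := exists_min_add (g := g) (lowerSemicontinuous_ite_top hs)
    (by intro x; simp only [g]; split_ifs <;> simp) (by rwa [hgs]) (ψ := ψ)
    hcont.continuousOn hbd (κ := 0 + β⁻¹) (by simpa using hβ)
    (by rw [hgs]; simpa only [hg0, zero_add] using hstrong)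
  rw [hgs] at hz hmin
  simp only [hg0, zero_add] at hmin
  refine ⟨z, lam + β⁻¹ • (u - z), hz, ?_, fun z' hz' => ?_⟩
  · rw [add_sub_cancel_left, smul_smul, mul_inv_cancel₀ hβ.ne', one_smul]
  · have : 0 ≤ p.h₁ z'.fst - p.h₁ z.fst - ⟪lam + β⁻¹ • (u - z), z' - z⟫_ℝ := by
      refine nonneg_of_forall_add_mul (b := β⁻¹ / 2 * ‖z' - z‖ ^ 2) fun t h0 h1 => ?_
      have h2 := hmin _ (segment_mem hsconv hz hz' h0.le h1.le)
      have h3 := ConvexOn.segment_le hcv hz hz' h0.le h1.le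
      simp only [ψ] at h2
      have e1 : z + t • (z' - z) - w = (z - w) + t • (z' - z) := by module
      have e2 : lam + β⁻¹ • (u - z) = -(β⁻¹ • (z - w)) := by
        rw [hw]
        have : β⁻¹ • β • lam = lam := by rw [smul_smul, inv_mul_cancel₀ hβ.ne', one_smul]
        rw [sub_add_eq_sub_sub, smul_sub, smul_sub, this, smul_sub]
        abel
      rw [e1, norm_add_smul_sq] at h2
      rw [e2, inner_neg_left, inner_smul_left]
      simp only [conj_trivial]
      have h4 : 0 ≤ t * (p.h₁ z'.fst - p.h₁ z.fst - -(β⁻¹ * ⟪z - w, z' - z⟫_ℝ)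
          + t * (β⁻¹ / 2 * ‖z' - z‖ ^ 2)) := by
        linarith
      exact nonneg_of_mul_nonneg_right h4 h0
    linarith

/-! ### Fenchel conjugate and the maximiser of the smoothing problem -/

theorem h_of_mem {z : Dual d₁ d₂} (hz : z.snd ∈ p.K) : p.h z = (p.h₁ z.fst : EReal) := by
  simp [h, hz]

theorem h_of_notMem {z : Dual d₁ d₂} (hz : z.snd ∉ p.K) : p.h z = ⊤ := by
  simp [h, hz]

theorem le_hConj (v : Dual d₁ d₂) {z : Dual d₁ d₂} (hz : z.snd ∈ p.K) :
    ((⟪v, z⟫_ℝ - p.h₁ z.fst : ℝ) : EReal) ≤ p.hConj v := by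
  have := le_iSup (fun u : Dual d₁ d₂ => ((⟪v, u⟫_ℝ : ℝ) : EReal) - p.h u) z
  simp only [h_of_mem hz] at this
  exact_mod_cast this

theorem Admissible.hConj_ne_bot (hp : p.Admissible) (v : Dual d₁ d₂) : p.hConj v ≠ ⊥ := by
  obtain ⟨k, hk⟩ := hp.K_nonempty
  have := le_hConj (p := p) v (z := WithLp.toLp 2 (0, k)) hk
  intro h
  rw [h] at this
  exact absurd (le_bot_iff.1 this) (EReal.coe_ne_bot _)

theorem Admissible.hConj_eq (hp : p.Admissible) {v : Dual d₁ d₂} (hv : v ∈ effDom p.hConj) :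
    p.hConj v = (p.hc v : EReal) :=
  (EReal.coe_toReal (ne_of_lt hv) (hp.hConj_ne_bot v)).symm

/-- Fenchel–Young inequality. -/
theorem Admissible.le_hc (hp : p.Admissible) {v : Dual d₁ d₂} (hv : v ∈ effDom p.hConj)
    {z : Dual d₁ d₂} (hz : z.snd ∈ p.K) : ⟪v, z⟫_ℝ - p.h₁ z.fst ≤ p.hc v := by
  have := le_hConj (p := p) v hz
  rw [hp.hConj_eq hv] at this
  exact_mod_cast this

namespace IsProx

variable {u lam : Dual d₁ d₂} {β : ℝ} {z v : Dual d₁ d₂}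

/-- The subgradient relation is the equality case of Fenchel–Young, so the supremum is attained at
`z`. -/
theorem hConj_eq (h : p.IsProx u lam β z v) :
    p.hConj v = ((⟪v, z⟫_ℝ - p.h₁ z.fst : ℝ) : EReal) := by
  refine le_antisymm (iSup_le fun z' => ?_) (le_hConj v h.mem)
  by_cases hz' : z'.snd ∈ p.K
  · rw [h_of_mem hz']
    have := h.sub z' hz'
    rw [inner_sub_right] at this
    have h2 : ⟪v, z'⟫_ℝ - p.h₁ z'.fst ≤ ⟪v, z⟫_ℝ - p.h₁ z.fst := by linarith
    exact_mod_cast h2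
  · rw [h_of_notMem hz']
    simp

theorem mem_dom (h : p.IsProx u lam β z v) : v ∈ effDom p.hConj := by
  show p.hConj v < ⊤
  rw [h.hConj_eq]
  exact EReal.coe_lt_top _

theorem hc_eq (h : p.IsProx u lam β z v) : p.hc v = ⟪v, z⟫_ℝ - p.h₁ z.fst := by
  rw [hc, h.hConj_eq, EReal.toReal_coe]

/-- `z` is a subgradient of the conjugate at `v`. -/
theorem hc_sub (h : p.IsProx u lam β z v) (hp : p.Admissible) {w : Dual d₁ d₂}
    (hw : w ∈ effDom p.hConj) : p.hc v + ⟪w - v, z⟫_ℝ ≤ p.hc w := by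
  have := hp.le_hc hw h.mem
  rw [h.hc_eq, inner_sub_left]
  linarith

theorem z_eq (h : p.IsProx u lam β z v) : z = u - β • (v - lam) := by
  rw [h.eq]; abel

/-- Strong concavity of the smoothing objective at its maximiser. -/
theorem real_obj_le (h : p.IsProx u lam β z v) (hp : p.Admissible) {w : Dual d₁ d₂}
    (hw : w ∈ effDom p.hConj) :
    ⟪w, u⟫_ℝ - p.hc w - β / 2 * ‖w - lam‖ ^ 2 + β / 2 * ‖w - v‖ ^ 2
      ≤ ⟪v, u⟫_ℝ - p.hc v - β / 2 * ‖v - lam‖ ^ 2 := by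
  have h1 := h.hc_sub hp hw
  rw [h.z_eq, inner_sub_right, inner_smul_right] at h1
  have e : w - lam = (w - v) + (1 : ℝ) • (v - lam) := by module
  rw [e, norm_add_smul_sq]
  rw [inner_sub_left w v u] at h1
  linarith

theorem smoothObj_eq (hp : p.Admissible) {w : Dual d₁ d₂} (hw : w ∈ effDom p.hConj) :
    p.smoothObj u lam β w = ((⟪w, u⟫_ℝ - p.hc w - β / 2 * ‖w - lam‖ ^ 2 : ℝ) : EReal) := by
  rw [smoothObj, hp.hConj_eq hw]
  norm_cast

theorem smoothObj_eq_bot {w : Dual d₁ d₂} (hw : w ∉ effDom p.hConj) :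
    p.smoothObj u lam β w = ⊥ := by
  have : p.hConj w = ⊤ := by
    by_contra h
    exact hw (lt_top_iff_ne_top.2 h)
  rw [smoothObj, this]
  simp

theorem smoothObj_le (h : p.IsProx u lam β z v) (hp : p.Admissible) (hβ : 0 < β)
    (w : Dual d₁ d₂) : p.smoothObj u lam β w ≤ p.smoothObj u lam β v := by
  by_cases hw : w ∈ effDom p.hConj
  · rw [smoothObj_eq hp hw, smoothObj_eq hp h.mem_dom]
    have h1 := h.real_obj_le hp hw
    have h2 : 0 ≤ β / 2 * ‖w - v‖ ^ 2 := by positivity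
    exact_mod_cast (by linarith)
  · rw [smoothObj_eq_bot hw]
    exact bot_le

/-- Strong concavity allows a single maximiser, so the arbitrary choice in `argmax` is pinned to the
subgradient supplied by the proximal point. -/
theorem lam_eq (h : p.IsProx u lam β z v) (hp : p.Admissible) (hβ : 0 < β) :
    p.Lam u lam β = v := by
  have h1 : ∀ w, p.smoothObj u lam β w ≤ p.smoothObj u lam β (p.Lam u lam β) :=
    Classical.epsilon_spec (p := fun z => ∀ w, p.smoothObj u lam β w ≤ p.smoothObj u lam β z)
      ⟨v, h.smoothObj_le hp hβ⟩
  set w := p.Lam u lam β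
  have h2 := h1 v
  by_cases hw : w ∈ effDom p.hConj
  · rw [smoothObj_eq hp hw, smoothObj_eq hp h.mem_dom] at h2
    have h3 := h.real_obj_le hp hw
    have h4 : ⟪v, u⟫_ℝ - p.hc v - β / 2 * ‖v - lam‖ ^ 2
      ≤ ⟪w, u⟫_ℝ - p.hc w - β / 2 * ‖w - lam‖ ^ 2 := by exact_mod_cast h2
    have h5 : β / 2 * ‖w - v‖ ^ 2 ≤ 0 := by linarith
    have h6 : ‖w - v‖ ^ 2 ≤ 0 := by
      by_contra hc
      have : 0 < β / 2 * ‖w - v‖ ^ 2 := mul_pos (by linarith) (not_le.1 hc)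
      linarith
    have h7 : ‖w - v‖ = 0 := by nlinarith [norm_nonneg (w - v)]
    exact sub_eq_zero.1 (norm_eq_zero.1 h7)
  · rw [smoothObj_eq_bot hw, smoothObj_eq hp h.mem_dom] at h2
    exact absurd (le_bot_iff.1 h2) (EReal.coe_ne_bot _)

theorem hSmooth_eq (h : p.IsProx u lam β z v) (hp : p.Admissible) (hβ : 0 < β) :
    p.hSmooth u lam β = ((⟪v, u⟫_ℝ - p.hc v - β / 2 * ‖v - lam‖ ^ 2 : ℝ) : EReal) := by
  rw [← smoothObj_eq hp h.mem_dom]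
  exact le_antisymm (iSup_le (h.smoothObj_le hp hβ)) (le_iSup (p.smoothObj u lam β) v)

theorem hs_eq (h : p.IsProx u lam β z v) (hp : p.Admissible) (hβ : 0 < β) :
    p.hs u lam β = ⟪v, u⟫_ℝ - p.hc v - β / 2 * ‖v - lam‖ ^ 2 := by
  rw [hs, h.hSmooth_eq hp hβ, EReal.toReal_coe]

end IsProx

variable {lam : Dual d₁ d₂} {β : ℝ}

/-- The proximal point of `β h` at `u + β lam`. -/
def proxPt (p : Problem n d₁ d₂) (u lam : Dual d₁ d₂) (β : ℝ) : Dual d₁ d₂ :=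
  u - β • (p.Lam u lam β - lam)

theorem Admissible.isProx (hp : p.Admissible) (hβ : 0 < β) (u lam : Dual d₁ d₂) :
    p.IsProx u lam β (p.proxPt u lam β) (p.Lam u lam β) := by
  obtain ⟨z, v, h⟩ := hp.exists_isProx u lam hβ
  have h1 := h.lam_eq hp hβ
  have h2 : p.proxPt u lam β = z := by rw [proxPt, h1, h.z_eq]
  rw [h1, h2]
  exact h

theorem Admissible.hSmooth_eq_coe (hp : p.Admissible) (hβ : 0 < β) (u lam : Dual d₁ d₂) :
    p.hSmooth u lam β = (p.hs u lam β : EReal) := by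
  rw [(hp.isProx hβ u lam).hs_eq hp hβ, (hp.isProx hβ u lam).hSmooth_eq hp hβ]

theorem Admissible.hs_eq (hp : p.Admissible) (hβ : 0 < β) (u lam : Dual d₁ d₂) :
    p.hs u lam β = ⟪p.Lam u lam β, u⟫_ℝ - p.hc (p.Lam u lam β)
      - β / 2 * ‖p.Lam u lam β - lam‖ ^ 2 :=
  (hp.isProx hβ u lam).hs_eq hp hβ

theorem Admissible.lam_mem (hp : p.Admissible) (hβ : 0 < β) (u lam : Dual d₁ d₂) :
    p.Lam u lam β ∈ effDom p.hConj := (hp.isProx hβ u lam).mem_dom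

theorem Admissible.le_hs (hp : p.Admissible) (hβ : 0 < β) (u lam : Dual d₁ d₂) {w : Dual d₁ d₂}
    (hw : w ∈ effDom p.hConj) :
    ⟪w, u⟫_ℝ - p.hc w - β / 2 * ‖w - lam‖ ^ 2 + β / 2 * ‖w - p.Lam u lam β‖ ^ 2
      ≤ p.hs u lam β := by
  rw [hp.hs_eq hβ]
  exact (hp.isProx hβ u lam).real_obj_le hp hw

/-- The smoothed function as a Moreau envelope. -/
theorem Admissible.hs_eq_prox (hp : p.Admissible) (hβ : 0 < β) (u lam : Dual d₁ d₂) :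
    p.hs u lam β = p.h₁ (p.proxPt u lam β).fst + ⟪lam, u - p.proxPt u lam β⟫_ℝ
      + β / 2 * ‖p.Lam u lam β - lam‖ ^ 2 := by
  have h := hp.isProx hβ u lam
  rw [hp.hs_eq hβ, h.hc_eq]
  have e : ⟪p.Lam u lam β, u⟫_ℝ - ⟪p.Lam u lam β, p.proxPt u lam β⟫_ℝ
      = ⟪lam, u - p.proxPt u lam β⟫_ℝ + β * ‖p.Lam u lam β - lam‖ ^ 2 := by
    rw [← inner_sub_right, ← h.eq, inner_smul_right, inner_smul_right,
      ← real_inner_self_eq_norm_sq, inner_sub_left (p.Lam u lam β) lam]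
    ring
  linarith

/-- Every point of `dom h` bounds the Moreau envelope from above. -/
theorem Admissible.hs_le (hp : p.Admissible) (hβ : 0 < β) (u lam : Dual d₁ d₂) {z : Dual d₁ d₂}
    (hz : z.snd ∈ p.K) :
    p.hs u lam β ≤ p.h₁ z.fst + ⟪lam, u - z⟫_ℝ + β⁻¹ / 2 * ‖u - z‖ ^ 2 := by
  have h := hp.isProx hβ u lam
  set v := p.Lam u lam β
  have h1 := hp.le_hc h.mem_dom hz
  rw [hp.hs_eq hβ]
  -- Expanding this square supplies the Young inequality between `u - z` and `v - lam`;
  -- Fenchel–Young at `v` and `z` does the rest.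
  have h2 : 0 ≤ β⁻¹ / 2 * ‖(u - z) + (-β) • (v - lam)‖ ^ 2 := by positivity
  rw [norm_add_smul_sq, real_inner_comm, inner_sub_left v lam, inner_sub_right v u z] at h2
  have h3 : β⁻¹ / 2 * (‖u - z‖ ^ 2 + 2 * -β * (⟪v, u⟫_ℝ - ⟪v, z⟫_ℝ - ⟪lam, u - z⟫_ℝ)
      + (-β) ^ 2 * ‖v - lam‖ ^ 2) = β⁻¹ / 2 * ‖u - z‖ ^ 2
      - (⟪v, u⟫_ℝ - ⟪v, z⟫_ℝ - ⟪lam, u - z⟫_ℝ) + β / 2 * ‖v - lam‖ ^ 2 := by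
    field_simp
    ring
  linarith

/-- The multiplier optimal at `u` remains a competitor at `u'`, and only the linear term of the
objective depends on `u`. -/
theorem Admissible.hs_ge_linear (hp : p.Admissible) (hβ : 0 < β) (lam u u' : Dual d₁ d₂) :
    p.hs u lam β + ⟪p.Lam u lam β, u' - u⟫_ℝ ≤ p.hs u' lam β := by
  have h := hp.le_hs hβ u' lam (hp.lam_mem hβ u lam)
  rw [hp.hs_eq hβ u lam, inner_sub_right]
  have : 0 ≤ β / 2 * ‖p.Lam u lam β - p.Lam u' lam β‖ ^ 2 := by positivity
  linarith

/-- The proximal point of `u` is a competitor in the Moreau envelope at `u'`. Together with the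
linear lower bound, this makes the multiplier the gradient of the smoothed function, with smoothness
constant `1/β`. -/
theorem Admissible.hs_le_quadratic (hp : p.Admissible) (hβ : 0 < β) (lam u u' : Dual d₁ d₂) :
    p.hs u' lam β ≤ p.hs u lam β + ⟪p.Lam u lam β, u' - u⟫_ℝ + β⁻¹ / 2 * ‖u' - u‖ ^ 2 := by
  have h := hp.isProx hβ u lam
  have h1 := hp.hs_le hβ u' lam h.mem
  rw [hp.hs_eq_prox hβ u lam]
  set v := p.Lam u lam β
  have e : u' - p.proxPt u lam β = (u' - u) + β • (v - lam) := by rw [h.eq]; abel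
  have e2 : u - p.proxPt u lam β = β • (v - lam) := h.eq.symm
  rw [e, norm_add_smul_sq, inner_add_right] at h1
  rw [e2]
  have h3 : β⁻¹ / 2 * (‖u' - u‖ ^ 2 + 2 * β * ⟪u' - u, v - lam⟫_ℝ + β ^ 2 * ‖v - lam‖ ^ 2)
      = β⁻¹ / 2 * ‖u' - u‖ ^ 2 + ⟪u' - u, v - lam⟫_ℝ + β / 2 * ‖v - lam‖ ^ 2 := by
    field_simp
  rw [h3, inner_sub_right (u' - u), real_inner_comm lam, real_inner_comm v] at h1
  linarith

/-- The displacement of the multiplier does not grow from one stage to the next. -/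
theorem Admissible.norm_lam_sub_le (hp : p.Admissible) (hβ : 0 < β) {β' : ℝ} (hβ' : 0 < β')
    (u lam : Dual d₁ d₂) :
    β' * ‖p.Lam u (p.Lam u lam β) β' - p.Lam u lam β‖ ≤ β * ‖p.Lam u lam β - lam‖ := by
  have h := hp.isProx hβ u lam
  set v := p.Lam u lam β
  have h' := hp.isProx hβ' u v
  set v' := p.Lam u v β'
  -- This is monotonicity of the subdifferential of `h*`: the two proximal points are subgradients
  -- at `v` and `v'`, and their common part `u` cancels.
  have h1 := h.hc_sub hp h'.mem_dom
  have h2 := h'.hc_sub hp h.mem_dom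
  rw [h.z_eq] at h1
  rw [h'.z_eq] at h2
  have e : v - v' = -(v' - v) := by abel
  rw [e, inner_neg_left, inner_sub_right, inner_smul_right, real_inner_self_eq_norm_sq] at h2
  rw [inner_sub_right, inner_smul_right] at h1
  have h3 := real_inner_le_norm (v' - v) (v - lam)
  have h4 := mul_le_mul_of_nonneg_left h3 hβ.le
  have h5 : ‖v' - v‖ * (β' * ‖v' - v‖) ≤ ‖v' - v‖ * (β * ‖v - lam‖) := by linarith
  rcases (norm_nonneg (v' - v)).eq_or_lt with h6 | h6
  · rw [← h6, mul_zero]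
    positivity
  · exact le_of_mul_le_mul_left h5 h6

/-! ### The smooth part of the inner objective -/

/-- Real value of `f`. -/
def fR (p : Problem n d₁ d₂) (x : Primal n) : ℝ := (p.f x).toReal

/-- Real value of `g`. -/
def gR (p : Problem n d₁ d₂) (x : Primal n) : ℝ := (p.g x).toReal

theorem φ_eq (p : Problem n d₁ d₂) (lam : Dual d₁ d₂) (β : ℝ) (x : Primal n) :
    p.φ lam β x = p.fR x + p.hs (p.A x) lam β := rfl

theorem Admissible.dom_subset (hp : p.Admissible) : effDom p.g ⊆ effDom p.f := by
  obtain ⟨U, _, h1, h2, _⟩ := hp.f_diff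
  exact h1.trans h2

theorem Admissible.f_eq (hp : p.Admissible) {x : Primal n} (hx : x ∈ effDom p.g) :
    p.f x = (p.fR x : EReal) :=
  (EReal.coe_toReal (ne_of_lt (hp.dom_subset hx)) (hp.f_ne_bot x)).symm

theorem Admissible.g_eq (hp : p.Admissible) {x : Primal n} (hx : x ∈ effDom p.g) :
    p.g x = (p.gR x : EReal) :=
  (EReal.coe_toReal (ne_of_lt hx) (hp.g_ne_bot x)).symm

theorem Admissible.dom_convex (hp : p.Admissible) : Convex ℝ (effDom p.g) := hp.g_convex.1

theorem Admissible.gR_convex (hp : p.Admissible) : ConvexOn ℝ (effDom p.g) p.gR :=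
  strongConvexOn_zero.1 (StrongConvexOn.mono hp.μ_nonneg hp.g_convex)

theorem Admissible.fR_convex (hp : p.Admissible) : ConvexOn ℝ (effDom p.g) p.fR :=
  hp.f_convex.subset hp.dom_subset hp.dom_convex

theorem Admissible.fR_hasGradientAt (hp : p.Admissible) {x : Primal n} (hx : x ∈ effDom p.g) :
    HasGradientAt p.fR (gradient p.fR x) x := by
  obtain ⟨U, hU, h1, _, h3⟩ := hp.f_diff
  exact ((h3 x (h1 hx)).differentiableAt (hU.mem_nhds (h1 hx))).hasGradientAt

theorem inner_adjoint (p : Problem n d₁ d₂) (v : Dual d₁ d₂) (x : Primal n) :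
    ⟪ContinuousLinearMap.adjoint p.A v, x⟫_ℝ = ⟪v, p.A x⟫_ℝ :=
  ContinuousLinearMap.adjoint_inner_left _ _ _

theorem norm_A_sub_sq_le (p : Problem n d₁ d₂) (x y : Primal n) :
    ‖p.A y - p.A x‖ ^ 2 ≤ ‖p.A‖ ^ 2 * ‖y - x‖ ^ 2 := by
  rw [← map_sub, ← mul_pow]
  exact pow_le_pow_left₀ (norm_nonneg _) (p.A.le_opNorm _) 2

theorem Admissible.hs_comp_le (hp : p.Admissible) (hβ : 0 < β) (lam : Dual d₁ d₂)
    (x y : Primal n) : p.hs (p.A y) lam β ≤ p.hs (p.A x) lam β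
      + ⟪ContinuousLinearMap.adjoint p.A (p.Lam (p.A x) lam β), y - x⟫_ℝ
      + β⁻¹ / 2 * ‖p.A‖ ^ 2 * ‖y - x‖ ^ 2 := by
  have h := hp.hs_le_quadratic hβ lam (p.A x) (p.A y)
  rw [inner_adjoint, map_sub]
  have h1 := mul_le_mul_of_nonneg_left (p.norm_A_sub_sq_le x y) (by positivity : 0 ≤ β⁻¹ / 2)
  linarith

theorem Admissible.hs_comp_ge (hp : p.Admissible) (hβ : 0 < β) (lam : Dual d₁ d₂)
    (x y : Primal n) : p.hs (p.A x) lam β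
      + ⟪ContinuousLinearMap.adjoint p.A (p.Lam (p.A x) lam β), y - x⟫_ℝ
      ≤ p.hs (p.A y) lam β := by
  have h := hp.hs_ge_linear hβ lam (p.A x) (p.A y)
  rwa [inner_adjoint, map_sub]

theorem Admissible.φ_hasGradientAt (hp : p.Admissible) (hβ : 0 < β) (lam : Dual d₁ d₂)
    {x : Primal n} (hx : x ∈ effDom p.g) : HasGradientAt (p.φ lam β)
      (gradient p.fR x + ContinuousLinearMap.adjoint p.A (p.Lam (p.A x) lam β)) x := by
  have h1 := (hp.fR_hasGradientAt hx).hasFDerivAt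
  have h2 : HasGradientAt (fun y => p.hs (p.A y) lam β)
      (ContinuousLinearMap.adjoint p.A (p.Lam (p.A x) lam β)) x :=
    hasGradientAt_of_sandwich (hp.hs_comp_ge hβ lam x) (hp.hs_comp_le hβ lam x)
  have h3 := h1.add h2.hasFDerivAt
  rw [← map_add] at h3
  exact hasGradientAt_iff_hasFDerivAt.2 h3

theorem Admissible.gradient_φ (hp : p.Admissible) (hβ : 0 < β) (lam : Dual d₁ d₂)
    {x : Primal n} (hx : x ∈ effDom p.g) : gradient (p.φ lam β) x =
      gradient p.fR x + ContinuousLinearMap.adjoint p.A (p.Lam (p.A x) lam β) :=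
  (hp.φ_hasGradientAt hβ lam hx).gradient

theorem Admissible.φ_continuousOn (hp : p.Admissible) (hβ : 0 < β) (lam : Dual d₁ d₂) :
    ContinuousOn (p.φ lam β) (effDom p.g) := fun _ hx =>
  (hp.φ_hasGradientAt hβ lam hx).hasFDerivAt.continuousAt.continuousWithinAt

theorem Admissible.φ_ge (hp : p.Admissible) (hβ : 0 < β) (lam : Dual d₁ d₂)
    {x y : Primal n} (hx : x ∈ effDom p.g) (hy : y ∈ effDom p.g) :
    p.φ lam β x + ⟪gradient (p.φ lam β) x, y - x⟫_ℝ ≤ p.φ lam β y := by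
  rw [hp.gradient_φ hβ lam hx, inner_add_left, φ_eq, φ_eq]
  have h1 := ConvexOn.gradient_le hp.fR_convex hx hy (hp.fR_hasGradientAt hx)
  have h2 := hp.hs_comp_ge hβ lam x y
  linarith

theorem Admissible.φ_le (hp : p.Admissible) (hβ : 0 < β) (lam : Dual d₁ d₂)
    {x y : Primal n} (hx : x ∈ effDom p.g) (hy : y ∈ effDom p.g) :
    p.φ lam β y ≤ p.φ lam β x + ⟪gradient (p.φ lam β) x, y - x⟫_ℝ
      + p.M β / 2 * ‖y - x‖ ^ 2 := by
  rw [hp.gradient_φ hβ lam hx, inner_add_left, φ_eq, φ_eq, M]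
  have h1 := hp.f_smooth x hx y hy
  rw [norm_sub_rev x y] at h1
  have h1' : p.fR y - p.fR x - ⟪gradient p.fR x, y - x⟫_ℝ ≤ p.L / 2 * ‖y - x‖ ^ 2 := h1
  have h2 := hp.hs_comp_le hβ lam x y
  have e : (p.L + ‖p.A‖ ^ 2 / β) / 2 * ‖y - x‖ ^ 2
      = p.L / 2 * ‖y - x‖ ^ 2 + β⁻¹ / 2 * ‖p.A‖ ^ 2 * ‖y - x‖ ^ 2 := by
    rw [div_eq_mul_inv (‖p.A‖ ^ 2)]; ring
  linarith

/-- The gradient inequality is taken at the convex combination, towards both ends; the inner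
products cancel in the weighted average. -/
theorem Admissible.φ_convexOn (hp : p.Admissible) (hβ : 0 < β) (lam : Dual d₁ d₂) :
    ConvexOn ℝ (effDom p.g) (p.φ lam β) := by
  refine ⟨hp.dom_convex, fun x hx y hy a b ha hb hab => ?_⟩
  have hm := hp.dom_convex hx hy ha hb hab
  have h1 := hp.φ_ge hβ lam hm hx
  have h2 := hp.φ_ge hβ lam hm hy
  obtain rfl : a = 1 - b := by linarith
  set v := gradient (p.φ lam β) ((1 - b) • x + b • y)
  have e1 : x - ((1 - b) • x + b • y) = (-b) • (y - x) := by module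
  have e2 : y - ((1 - b) • x + b • y) = (1 - b) • (y - x) := by module
  rw [e1, inner_smul_right] at h1
  rw [e2, inner_smul_right] at h2
  have h3 := mul_le_mul_of_nonneg_left h1 ha
  have h4 := mul_le_mul_of_nonneg_left h2 hb
  simp only [smul_eq_mul]
  linarith

theorem Admissible.M_pos (hp : p.Admissible) (hβ : 0 < β) : 0 < p.M β := by
  have := hp.L_pos
  unfold M
  positivity

/-- Real value of the inner objective. -/
def HR (p : Problem n d₁ d₂) (y : Primal n) (lam : Dual d₁ d₂) (β : ℝ) (x : Primal n) : ℝ :=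
  p.φ lam β x + (p.gR x + β / 2 * ‖x - y‖ ^ 2)

theorem Admissible.H_eq (hp : p.Admissible) (hβ : 0 < β) (y : Primal n) (lam : Dual d₁ d₂)
    {x : Primal n} (hx : x ∈ effDom p.g) : p.H y lam β x = (p.HR y lam β x : EReal) := by
  rw [H, hp.f_eq hx, hp.g_eq hx, hp.hSmooth_eq_coe hβ, HR, φ_eq]
  norm_cast
  ring

theorem Admissible.PR_strong (hp : p.Admissible) (y : Primal n) (β : ℝ) :
    StrongConvexOn (effDom p.g) (p.μ + β) fun x => p.gR x + β / 2 * ‖x - y‖ ^ 2 :=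
  strongConvexOn_add_sq hp.g_convex β y

theorem Admissible.HR_strong (hp : p.Admissible) (hβ : 0 < β) (y : Primal n)
    (lam : Dual d₁ d₂) : StrongConvexOn (effDom p.g) (p.μ + β) (p.HR y lam β) :=
  ConvexOn.add_strongConvexOn (hp.φ_convexOn hβ lam) (hp.PR_strong y β)

theorem Admissible.exists_min_HR (hp : p.Admissible) (hβ : 0 < β) (y : Primal n)
    (lam : Dual d₁ d₂) :
    ∃ z ∈ effDom p.g, ∀ w ∈ effDom p.g, p.HR y lam β z ≤ p.HR y lam β w := by
  obtain ⟨x₀, hx₀⟩ := hp.g_proper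
  have e : ∀ x, p.HR y lam β x = (p.g x).toReal + (p.φ lam β x + β / 2 * ‖x - y‖ ^ 2) := by
    intro x
    show p.φ lam β x + (p.gR x + _) = p.gR x + _
    ring
  have hs := hp.HR_strong hβ y lam
  have e' : p.HR y lam β = fun x => (p.g x).toReal + (p.φ lam β x + β / 2 * ‖x - y‖ ^ 2) :=
    funext e
  rw [e'] at hs
  have := hp.μ_nonneg
  obtain ⟨z, hz, h⟩ := exists_min_add hp.g_closed hp.g_ne_bot hp.g_proper
    (ψ := fun x => p.φ lam β x + β / 2 * ‖x - y‖ ^ 2)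
    ((hp.φ_continuousOn hβ lam).add (by fun_prop))
    (c := p.φ lam β x₀ - ⟪gradient (p.φ lam β) x₀, x₀⟫_ℝ) (b := gradient (p.φ lam β) x₀)
    (fun x hx => by
      have h1 := hp.φ_ge hβ lam hx₀ hx
      rw [inner_sub_right] at h1
      have h2 : 0 ≤ β / 2 * ‖x - y‖ ^ 2 := by positivity
      linarith) (by linarith) hs
  exact ⟨z, hz, fun w hw => by rw [e, e]; exact h w hw⟩

/-! ### Convergence of the accelerated proximal gradient method -/

/-- Optimality of the proximal step. -/
theorem Admissible.apgStep_spec (hp : p.Admissible) (hβ : 0 < β) (y : Primal n)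
    (lam : Dual d₁ d₂) {S : APGState n} (hθ : 0 < S.θ) :
    let yk : Primal n := (1 - S.θ) • S.x + S.θ • S.z
    let z' := (apgStep (p.φ lam β) (p.P y β) (p.M β) S).z
    z' ∈ effDom p.g ∧ ∀ w ∈ effDom p.g,
      ⟪gradient (p.φ lam β) yk, z' - yk⟫_ℝ + (p.gR z' + β / 2 * ‖z' - y‖ ^ 2)
        + S.θ * p.M β / 2 * ‖z' - S.z‖ ^ 2 + S.θ * p.M β / 2 * ‖w - z'‖ ^ 2
      ≤ ⟪gradient (p.φ lam β) yk, w - yk⟫_ℝ + (p.gR w + β / 2 * ‖w - y‖ ^ 2)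
        + S.θ * p.M β / 2 * ‖w - S.z‖ ^ 2 := by
  intro yk z'
  set b := gradient (p.φ lam β) yk
  have hM := hp.M_pos hβ
  have hμ := hp.μ_nonneg
  have hc : 0 < S.θ * p.M β := mul_pos hθ hM
  let Q : Primal n → ℝ := fun w => ⟪b, w - yk⟫_ℝ + (p.gR w + β / 2 * ‖w - y‖ ^ 2)
        + S.θ * p.M β / 2 * ‖w - S.z‖ ^ 2
  let q : Primal n → EReal := fun w => ((⟪b, w - yk⟫_ℝ : ℝ) : EReal) + p.P y β w
    + ((S.θ * p.M β / 2 * ‖w - S.z‖ ^ 2 : ℝ) : EReal)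
  have hQ : StrongConvexOn (effDom p.g) (p.μ + β + S.θ * p.M β) Q :=
    strongConvexOn_add_sq (strongConvexOn_add_affine (hp.PR_strong y β) b yk) _ S.z
  have hq : ∀ w ∈ effDom p.g, q w = (Q w : EReal) := by
    intro w hw
    simp only [q, Q, P, hp.g_eq hw]
    norm_cast
  have hqtop : ∀ w, w ∉ effDom p.g → q w = ⊤ := by
    intro w hw
    have : p.g w = ⊤ := by
      by_contra h
      exact hw (lt_top_iff_ne_top.2 h)
    simp only [q, P, this]
    rw [EReal.top_add_coe, EReal.coe_add_top, EReal.top_add_coe]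
  have hQe : Q = fun w => (p.g w).toReal + (⟪b, w - yk⟫_ℝ + β / 2 * ‖w - y‖ ^ 2
        + S.θ * p.M β / 2 * ‖w - S.z‖ ^ 2) := by
    funext w
    show ⟪b, w - yk⟫_ℝ + (p.gR w + β / 2 * ‖w - y‖ ^ 2)
        + S.θ * p.M β / 2 * ‖w - S.z‖ ^ 2 = p.gR w + _
    ring
  obtain ⟨m, hm, hmin⟩ : ∃ m ∈ effDom p.g, ∀ w ∈ effDom p.g, Q m ≤ Q w := by
    have hQ' := hQ
    rw [hQe] at hQ' ⊢
    refine exists_min_add hp.g_closed hp.g_ne_bot hp.g_proper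
      (ψ := fun w => ⟪b, w - yk⟫_ℝ + β / 2 * ‖w - y‖ ^ 2 + S.θ * p.M β / 2 * ‖w - S.z‖ ^ 2)
      (by fun_prop) (c := -⟪b, yk⟫_ℝ) (b := b) (fun x hx => ?_) (by linarith) hQ'
    rw [inner_sub_right]
    have h2 : 0 ≤ β / 2 * ‖x - y‖ ^ 2 := by positivity
    have h3 : 0 ≤ S.θ * p.M β / 2 * ‖x - S.z‖ ^ 2 := by positivity
    linarith
  have hz' : ∀ w, q z' ≤ q w := by
    refine Classical.epsilon_spec (p := fun z => ∀ w, q z ≤ q w) ⟨m, fun w => ?_⟩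
    by_cases hw : w ∈ effDom p.g
    · rw [hq m hm, hq w hw]
      exact_mod_cast hmin w hw
    · rw [hqtop w hw]
      exact le_top
  have hz'D : z' ∈ effDom p.g := by
    by_contra h
    have h1 := hz' m
    rw [hqtop z' h, hq m hm] at h1
    exact absurd (top_le_iff.1 h1) (EReal.coe_ne_top _)
  refine ⟨hz'D, fun w hw => ?_⟩
  have hmin' : ∀ w ∈ effDom p.g, Q z' ≤ Q w := by
    intro w hw
    have h1 := hz' w
    rw [hq z' hz'D, hq w hw] at h1
    exact_mod_cast h1
  have h2 := StrongConvexOn.quadratic_growth hQ hz'D hmin' hw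
  -- Of the modulus `μ + β + θ M` only `θ M` is kept. The scheme itself is analysed as in the convex
  -- case, and `μ + β` is exploited through the restarts.
  have h3 : 0 ≤ (p.μ + β) / 2 * ‖w - z'‖ ^ 2 := by positivity
  simp only [Q] at h2
  linarith

/-- One step of the method. -/
theorem Admissible.apgStep_decrease (hp : p.Admissible) (hβ : 0 < β) (y : Primal n)
    (lam : Dual d₁ d₂) {S : APGState n} (hθ : 0 < S.θ) (hθ1 : S.θ ≤ 1)
    (hx : S.x ∈ effDom p.g) (hz : S.z ∈ effDom p.g) :
    let S' := apgStep (p.φ lam β) (p.P y β) (p.M β) S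
    S'.x ∈ effDom p.g ∧ S'.z ∈ effDom p.g ∧ ∀ w ∈ effDom p.g,
      p.HR y lam β S'.x - p.HR y lam β w + S.θ ^ 2 * p.M β / 2 * ‖w - S'.z‖ ^ 2
        ≤ (1 - S.θ) * (p.HR y lam β S.x - p.HR y lam β w)
          + S.θ ^ 2 * p.M β / 2 * ‖w - S.z‖ ^ 2 := by
  intro S'
  obtain ⟨hz', hopt⟩ := hp.apgStep_spec hβ y lam hθ
  set z' := S'.z with hz'def
  have hx'def : S'.x = (1 - S.θ) • S.x + S.θ • z' := rfl
  have hx' : S'.x ∈ effDom p.g := by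
    rw [hx'def]
    exact hp.dom_convex hx hz' (by linarith) hθ.le (by ring)
  refine ⟨hx', hz', fun w hw => ?_⟩
  have hopt := hopt w hw
  set yk : Primal n := (1 - S.θ) • S.x + S.θ • S.z with hyk
  -- The gradient and smoothness inequalities are available only on `dom g`, so the extrapolated
  -- point has to stay there.
  have hykD : yk ∈ effDom p.g := hp.dom_convex hx hz (by linarith) hθ.le (by ring)
  change ⟪gradient (p.φ lam β) yk, z' - yk⟫_ℝ + (p.gR z' + β / 2 * ‖z' - y‖ ^ 2)
        + S.θ * p.M β / 2 * ‖z' - S.z‖ ^ 2 + S.θ * p.M β / 2 * ‖w - z'‖ ^ 2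
      ≤ ⟪gradient (p.φ lam β) yk, w - yk⟫_ℝ + (p.gR w + β / 2 * ‖w - y‖ ^ 2)
        + S.θ * p.M β / 2 * ‖w - S.z‖ ^ 2 at hopt
  have h1 := hp.φ_le hβ lam hykD hx'
  have h2 := hp.φ_ge hβ lam hykD hx
  have h3 := hp.φ_ge hβ lam hykD hw
  have hP0 : StrongConvexOn (effDom p.g) 0 fun x => p.gR x + β / 2 * ‖x - y‖ ^ 2 :=
    StrongConvexOn.mono (by have := hp.μ_nonneg; linarith) (hp.PR_strong y β)
  have h4 := (strongConvexOn_zero.1 hP0).2 hx hz' (by linarith : 0 ≤ 1 - S.θ) hθ.le (by ring)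
  simp only [smul_eq_mul] at h4
  rw [← hx'def] at h4
  set b := gradient (p.φ lam β) yk
  have e1 : S'.x - yk = S.θ • (z' - S.z) := by rw [hx'def, hyk]; module
  have e2 : ⟪b, S'.x - yk⟫_ℝ = (1 - S.θ) * ⟪b, S.x - yk⟫_ℝ + S.θ * ⟪b, z' - yk⟫_ℝ := by
    have : S'.x - yk = (1 - S.θ) • (S.x - yk) + S.θ • (z' - yk) := by rw [hx'def]; module
    rw [this, inner_add_right, inner_smul_right, inner_smul_right]
  have e3 : ‖S'.x - yk‖ ^ 2 = S.θ ^ 2 * ‖z' - S.z‖ ^ 2 := by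
    rw [e1, norm_smul, mul_pow, Real.norm_eq_abs, sq_abs]
  rw [e2, e3] at h1
  -- With these weights, the term `θ² M / 2 ‖z' - z‖²` from smoothness cancels the one from the
  -- optimality of the proximal step.
  have h5 := mul_le_mul_of_nonneg_left hopt hθ.le
  have h6 := mul_le_mul_of_nonneg_left h2 (by linarith : 0 ≤ 1 - S.θ)
  have h7 := mul_le_mul_of_nonneg_left h3 hθ.le
  unfold HR
  nlinarith

theorem theta_next_pos {θ : ℝ} (hθ : 0 < θ) : 0 < (√(θ ^ 4 + 4 * θ ^ 2) - θ ^ 2) / 2 := by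
  have : θ ^ 2 < √(θ ^ 4 + 4 * θ ^ 2) := by
    apply Real.lt_sqrt_of_sq_lt
    nlinarith [pow_pos hθ 2]
  linarith

/-- The update is the positive root of `t² = (1 - t) θ²`, the relation that makes the factor `1 - θ`
of the one-step estimate telescope. -/
theorem theta_next_sq (θ : ℝ) : ((√(θ ^ 4 + 4 * θ ^ 2) - θ ^ 2) / 2) ^ 2
    = (1 - (√(θ ^ 4 + 4 * θ ^ 2) - θ ^ 2) / 2) * θ ^ 2 := by
  have := Real.sq_sqrt (by positivity : 0 ≤ θ ^ 4 + 4 * θ ^ 2)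
  nlinarith

/-- From `θ² = (1 - θ) τ²` the bound `τ ≤ 2 / K` passes to `θ ≤ 2 / (K + 1)`. -/
theorem theta_le {θ τ K : ℝ} (hθ : 0 < θ) (hτ : 0 < τ) (h : θ ^ 2 = (1 - θ) * τ ^ 2)
    (hK : 0 < K) (hτK : τ * K ≤ 2) : θ * (K + 1) ≤ 2 := by
  by_contra hcon
  have hcon := not_le.1 hcon
  have hθ1 : θ < 1 := by
    by_contra h1
    have := not_lt.1 h1
    nlinarith [pow_pos hθ 2, pow_pos hτ 2]
  have h1 : θ ^ 2 * K ^ 2 = (1 - θ) * (τ * K) ^ 2 := by rw [mul_pow, ← mul_assoc, ← h]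
  have h2 : (τ * K) ^ 2 ≤ 4 := by nlinarith [mul_pos hτ hK]
  have h3 : θ ^ 2 * K ^ 2 ≤ (1 - θ) * 4 := by
    rw [h1]; exact mul_le_mul_of_nonneg_left h2 (by linarith)
  -- Squaring would give `(2 - θ)² < θ² K² ≤ 4 (1 - θ)`, that is `θ² < 0`.
  have h4 : 2 - θ < θ * K := by linarith
  nlinarith

/-- State of the method after `k + 1` iterations from `x`. -/
theorem Admissible.apg_invariant (hp : p.Admissible) (hβ : 0 < β) (y : Primal n)
    (lam : Dual d₁ d₂) {x : Primal n} (hx : x ∈ effDom p.g) (k : ℕ) :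
    let S := (apgStep (p.φ lam β) (p.P y β) (p.M β))^[k + 1] ⟨x, x, 1⟩
    S.x ∈ effDom p.g ∧ S.z ∈ effDom p.g ∧ 0 < S.θ ∧ S.θ ≤ 1 ∧
      ∃ τ : ℝ, 0 < τ ∧ τ * (k + 2) ≤ 2 ∧ S.θ ^ 2 = (1 - S.θ) * τ ^ 2 ∧
        ∀ w ∈ effDom p.g, p.HR y lam β S.x - p.HR y lam β w + τ ^ 2 * p.M β / 2 * ‖w - S.z‖ ^ 2
          ≤ τ ^ 2 * p.M β / 2 * ‖w - x‖ ^ 2 := by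
  have hle : ∀ θ τ : ℝ, 0 < θ → 0 < τ → θ ^ 2 = (1 - θ) * τ ^ 2 → θ ≤ 1 := by
    intro θ τ hθ hτ h
    by_contra h1
    have := not_le.1 h1
    nlinarith [pow_pos hθ 2, pow_pos hτ 2]
  induction k with
  | zero =>
    intro S
    have hS : S = apgStep (p.φ lam β) (p.P y β) (p.M β) ⟨x, x, 1⟩ := rfl
    have h := hp.apgStep_decrease hβ y lam (S := ⟨x, x, 1⟩) one_pos le_rfl hx hx
    simp only [← hS] at h
    obtain ⟨h1, h2, h3⟩ := h
    have hθ : S.θ = (√((1 : ℝ) ^ 4 + 4 * 1 ^ 2) - 1 ^ 2) / 2 := rfl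
    have hpos : 0 < S.θ := by rw [hθ]; exact theta_next_pos one_pos
    have hsq : S.θ ^ 2 = (1 - S.θ) * 1 ^ 2 := by rw [hθ]; exact theta_next_sq 1
    -- `τ` is the step parameter of the iteration just made. Here it is `θ₀ = 1`, which removes the
    -- initial gap from the right side and makes `2 τ ≤ 2` an equality.
    refine ⟨h1, h2, hpos, hle _ _ hpos one_pos hsq, 1, one_pos, by norm_num, hsq,
      fun w hw => ?_⟩
    have := h3 w hw
    linarith
  | succ k ih =>
    intro S
    set T := (apgStep (p.φ lam β) (p.P y β) (p.M β))^[k + 1] ⟨x, x, 1⟩ with hT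
    have hS : S = apgStep (p.φ lam β) (p.P y β) (p.M β) T :=
      Function.iterate_succ_apply' _ _ _
    obtain ⟨hx1, hz1, hpos, hone, τ, hτ, hτk, hsq, hb⟩ := ih
    have h := hp.apgStep_decrease hβ y lam (S := T) hpos hone hx1 hz1
    simp only [← hS] at h
    obtain ⟨h1, h2, h3⟩ := h
    have hθ : S.θ = (√(T.θ ^ 4 + 4 * T.θ ^ 2) - T.θ ^ 2) / 2 := by rw [hS]; rfl
    have hpos' : 0 < S.θ := by rw [hθ]; exact theta_next_pos hpos
    have hsq' : S.θ ^ 2 = (1 - S.θ) * T.θ ^ 2 := by rw [hθ]; exact theta_next_sq _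
    refine ⟨h1, h2, hpos', hle _ _ hpos' hpos hsq', T.θ, hpos, ?_, hsq', fun w hw => ?_⟩
    · have := theta_le hpos hτ hsq (K := k + 2) (by positivity) hτk
      push_cast
      linarith
    · have h4 := h3 w hw
      have h5 := mul_le_mul_of_nonneg_left (hb w hw) (by linarith : 0 ≤ 1 - T.θ)
      have e : ∀ c : ℝ, (1 - T.θ) * (τ ^ 2 * p.M β / 2 * c) = T.θ ^ 2 * p.M β / 2 * c := by
        intro c; rw [hsq]; ring
      rw [mul_add, e, e] at h5
      linarith

theorem Admissible.apg_mem (hp : p.Admissible) (hβ : 0 < β) (y : Primal n)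
    (lam : Dual d₁ d₂) {x : Primal n} (hx : x ∈ effDom p.g) (k : ℕ) :
    apg (p.φ lam β) (p.P y β) (p.M β) k x ∈ effDom p.g := by
  cases k with
  | zero => exact hx
  | succ k => exact (hp.apg_invariant hβ y lam hx k).1

theorem Admissible.apg_rate (hp : p.Admissible) (hβ : 0 < β) (y : Primal n)
    (lam : Dual d₁ d₂) {x w : Primal n} (hx : x ∈ effDom p.g) (hw : w ∈ effDom p.g) (k : ℕ) :
    p.HR y lam β (apg (p.φ lam β) (p.P y β) (p.M β) (k + 1) x) - p.HR y lam β w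
      ≤ 2 * p.M β / (k + 1) ^ 2 * ‖w - x‖ ^ 2 := by
  obtain ⟨_, _, _, _, τ, hτ, hτk, _, hb⟩ := hp.apg_invariant hβ y lam hx k
  have h1 := hb w hw
  have hM := hp.M_pos hβ
  have h2 : 0 ≤ τ ^ 2 * p.M β / 2 * ‖w - ((apgStep (p.φ lam β) (p.P y β) (p.M β))^[k + 1]
    ⟨x, x, 1⟩).z‖ ^ 2 := by positivity
  have hk : (0 : ℝ) < k + 1 := by positivity
  -- The available `k + 2` is weakened to the iteration count `k + 1`, to which the restart period
  -- is tuned.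
  have h3 : τ * (k + 1) ≤ 2 := by nlinarith
  have h4 : τ ^ 2 ≤ 4 / (k + 1) ^ 2 := by
    rw [le_div_iff₀ (by positivity), ← mul_pow]
    have : (0 : ℝ) ≤ τ * (k + 1) := by positivity
    nlinarith
  have h5 : τ ^ 2 * p.M β / 2 * ‖w - x‖ ^ 2 ≤ 4 / (k + 1) ^ 2 * p.M β / 2 * ‖w - x‖ ^ 2 := by
    gcongr
  have h6 : 4 / ((k : ℝ) + 1) ^ 2 * p.M β / 2 * ‖w - x‖ ^ 2
    = 2 * p.M β / (k + 1) ^ 2 * ‖w - x‖ ^ 2 := by ring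
  exact le_trans (by linarith! [h1, h2]) (h5.trans_eq h6)

/-- Comparing with the starting point itself makes the right side of the rate vanish. Iterations
beyond the last full period therefore do no harm. -/
theorem Admissible.apg_le (hp : p.Admissible) (hβ : 0 < β) (y : Primal n)
    (lam : Dual d₁ d₂) {x : Primal n} (hx : x ∈ effDom p.g) (k : ℕ) :
    p.HR y lam β (apg (p.φ lam β) (p.P y β) (p.M β) k x) ≤ p.HR y lam β x := by
  cases k with
  | zero => exact le_rfl
  | succ k =>
    have := hp.apg_rate hβ y lam hx hx k
    rw [sub_self, norm_zero] at this
    linarith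

theorem Admissible.N_pos (hp : p.Admissible) (hβ : 0 < β) : 0 < p.N β := by
  have h1 := hp.M_pos hβ
  have h2 := hp.μ_nonneg
  rw [N, Nat.ceil_pos]
  have : 0 < 2 * p.M β / (p.μ + β) := by positivity
  positivity

/-- A full period halves the optimality gap. -/
theorem Admissible.apg_halve (hp : p.Admissible) (hβ : 0 < β) (y : Primal n)
    (lam : Dual d₁ d₂) {x : Primal n} (hx : x ∈ effDom p.g) {B : ℝ}
    (hB : ∀ w ∈ effDom p.g, p.HR y lam β x - p.HR y lam β w ≤ B) :
    ∀ w ∈ effDom p.g,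
      p.HR y lam β (apg (p.φ lam β) (p.P y β) (p.M β) (p.N β) x) - p.HR y lam β w ≤ B / 2 := by
  obtain ⟨z, hz, hmin⟩ := hp.exists_min_HR hβ y lam
  have hN := hp.N_pos hβ
  obtain ⟨k, hk⟩ : ∃ k, p.N β = k + 1 := ⟨p.N β - 1, by omega⟩
  have hM := hp.M_pos hβ
  have hμ := hp.μ_nonneg
  have hκ : 0 < p.μ + β := by linarith
  intro w hw
  have h1 := hp.apg_rate hβ y lam hx hz k
  rw [← hk] at h1
  have h2 := StrongConvexOn.quadratic_growth (hp.HR_strong hβ y lam) hz hmin hx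
  have h3 := hB z hz
  rw [norm_sub_rev] at h2
  have h4 : 2 * √(2 * p.M β / (p.μ + β)) ≤ (k + 1 : ℝ) := by
    have := Nat.le_ceil (2 * √(2 * p.M β / (p.μ + β)))
    have h5 : (⌈2 * √(2 * p.M β / (p.μ + β))⌉₊ : ℝ) = k + 1 := by
      have : ⌈2 * √(2 * p.M β / (p.μ + β))⌉₊ = k + 1 := hk
      rw [this]; push_cast; ring
    linarith
  have h5 : 4 * (2 * p.M β / (p.μ + β)) ≤ (k + 1 : ℝ) ^ 2 := by
    have h6 := pow_le_pow_left₀ (by positivity) h4 2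
    rw [mul_pow, Real.sq_sqrt (by positivity)] at h6
    linarith
  -- Quadratic growth gives `‖z - x‖² ≤ 2 B / (μ + β)`, so the coefficient `(μ + β) / 4` yields `B /
  -- 2`.
  have h7 : 2 * p.M β / ((k : ℝ) + 1) ^ 2 ≤ (p.μ + β) / 4 := by
    rw [div_le_iff₀ (by positivity)]
    have h8 := mul_le_mul_of_nonneg_left h5 hκ.le
    have h9 : (p.μ + β) * (4 * (2 * p.M β / (p.μ + β))) = 8 * p.M β := by
      field_simp
      ring
    linarith
  have h8 := mul_le_mul_of_nonneg_right h7 (sq_nonneg ‖z - x‖)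
  have h9 := hmin w hw
  linarith

/-- `m` iterations of the inner solver reduce the gap by `2 ^ (m / N)`. -/
theorem Admissible.innerSolver_gap (hp : p.Admissible) (hβ : 0 < β) (y : Primal n)
    (lam : Dual d₁ d₂) {x : Primal n} (hx : x ∈ effDom p.g) {B : ℝ}
    (hB : ∀ w ∈ effDom p.g, p.HR y lam β x - p.HR y lam β w ≤ B) (m : ℕ) :
    p.innerSolver y lam β m x ∈ effDom p.g ∧ ∀ w ∈ effDom p.g,
      p.HR y lam β (p.innerSolver y lam β m x) - p.HR y lam β w ≤ B / 2 ^ (m / p.N β) := by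
  have key : ∀ j : ℕ, (apg (p.φ lam β) (p.P y β) (p.M β) (p.N β))^[j] x ∈ effDom p.g ∧
      ∀ w ∈ effDom p.g, p.HR y lam β ((apg (p.φ lam β) (p.P y β) (p.M β) (p.N β))^[j] x)
        - p.HR y lam β w ≤ B / 2 ^ j := by
    intro j
    induction j with
    | zero => exact ⟨hx, by simpa using hB⟩
    | succ j ih =>
      rw [Function.iterate_succ_apply']
      refine ⟨hp.apg_mem hβ y lam ih.1 _, fun w hw => ?_⟩
      have := hp.apg_halve hβ y lam ih.1 ih.2 w hw
      rwa [div_div, ← pow_succ] at this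
  obtain ⟨h1, h2⟩ := key (m / p.N β)
  refine ⟨hp.apg_mem hβ y lam h1 _, fun w hw => ?_⟩
  have h3 := hp.apg_le hβ y lam h1 (m % p.N β)
  have h4 := h2 w hw
  unfold innerSolver restartedAPG
  linarith

/-! ### Inexact proximal point steps on the saddle function -/

/-- Real form of the saddle point property. -/
structure IsSaddle (p : Problem n d₁ d₂) (xs : Primal n) (ls : Dual d₁ d₂) : Prop where
  primal_dom : xs ∈ effDom p.g
  dual_dom : ls ∈ effDom p.hConj
  feasible : p.A₂ xs ∈ p.K
  h_eq : p.h₁ (p.A₁ xs) = ⟪ls, p.A xs⟫_ℝ - p.hc ls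
  minimal : ∀ x ∈ effDom p.g,
    p.fR xs + p.gR xs + ⟪ls, p.A xs⟫_ℝ ≤ p.fR x + p.gR x + ⟪ls, p.A x⟫_ℝ

theorem A_fst (p : Problem n d₁ d₂) (x : Primal n) : (p.A x).fst = p.A₁ x := rfl

theorem Admissible.F_eq (hp : p.Admissible) {x : Primal n} (hx : x ∈ effDom p.g) :
    p.F x = ((p.fR x + p.gR x + p.h₁ (p.A₁ x) : ℝ) : EReal) := by
  rw [F, hp.f_eq hx, hp.g_eq hx]
  norm_cast

theorem Admissible.lagrangian_eq (hp : p.Admissible) {x : Primal n} (hx : x ∈ effDom p.g)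
    {l : Dual d₁ d₂} (hl : l ∈ effDom p.hConj) :
    p.lagrangian x l = ((p.fR x + p.gR x + ⟪l, p.A x⟫_ℝ - p.hc l : ℝ) : EReal) := by
  rw [lagrangian, hp.f_eq hx, hp.g_eq hx, hp.hConj_eq hl]
  norm_cast

/-- After cancelling the finite values of `f` and `g`, the first equality is Fenchel–Young with
equality, and the second is minimality of the Lagrangian in `x`. -/
theorem IsOptimalPair.isSaddle {xs : Primal n} {ls : Dual d₁ d₂} (hp : p.Admissible)
    (h : p.IsOptimalPair xs ls) : p.IsSaddle xs ls := by
  have h1 := h.primal_eq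
  have h2 := h.dual_eq
  rw [hp.F_eq h.primal_dom, hp.lagrangian_eq h.primal_dom h.dual_dom] at h1
  have h3 : p.fR xs + p.gR xs + p.h₁ (p.A₁ xs)
    = p.fR xs + p.gR xs + ⟪ls, p.A xs⟫_ℝ - p.hc ls := by exact_mod_cast h1
  refine ⟨h.primal_dom, h.dual_dom, h.feasible, by linarith, fun x hx => ?_⟩
  have h4 : p.lagrangian xs ls ≤ p.lagrangian x ls := by
    rw [h2]
    exact iInf_le _ x
  rw [hp.lagrangian_eq h.primal_dom h.dual_dom, hp.lagrangian_eq hx h.dual_dom] at h4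
  have h5 : p.fR xs + p.gR xs + ⟪ls, p.A xs⟫_ℝ - p.hc ls
    ≤ p.fR x + p.gR x + ⟪ls, p.A x⟫_ℝ - p.hc ls := by exact_mod_cast h4
  linarith

theorem HR_eq (p : Problem n d₁ d₂) (y : Primal n) (lam : Dual d₁ d₂) (β : ℝ) (x : Primal n) :
    p.HR y lam β x = p.fR x + p.gR x + p.hs (p.A x) lam β + β / 2 * ‖x - y‖ ^ 2 := by
  rw [HR, φ_eq]; ring

theorem Admissible.fg_convexOn (hp : p.Admissible) :
    ConvexOn ℝ (effDom p.g) fun x => p.fR x + p.gR x := hp.fR_convex.add hp.gR_convex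

/-- First-order optimality of the inner minimiser. -/
theorem Admissible.prox_opt (hp : p.Admissible) (hβ : 0 < β) {y xh : Primal n}
    (hxh : xh ∈ effDom p.g) (hmin : ∀ w ∈ effDom p.g, p.HR y lam β xh ≤ p.HR y lam β w)
    {x : Primal n} (hx : x ∈ effDom p.g) :
    p.fR xh + p.gR xh + ⟪p.Lam (p.A xh) lam β, p.A xh⟫_ℝ
      ≤ p.fR x + p.gR x + ⟪p.Lam (p.A xh) lam β, p.A x⟫_ℝ + β * ⟪xh - y, x - xh⟫_ℝ := by
  set v := p.Lam (p.A xh) lam β with hv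
  have : 0 ≤ (p.fR x + p.gR x) - (p.fR xh + p.gR xh) + ⟪v, p.A (x - xh)⟫_ℝ
      + β * ⟪xh - y, x - xh⟫_ℝ := by
    refine nonneg_of_forall_add_mul
      (b := β⁻¹ / 2 * ‖p.A (x - xh)‖ ^ 2 + β / 2 * ‖x - xh‖ ^ 2) fun t h0 h1 => ?_
    have h2 := hmin _ (segment_mem hp.dom_convex hxh hx h0.le h1.le)
    have h3 := ConvexOn.segment_le hp.fg_convexOn hxh hx h0.le h1.le
    have h4 := hp.hs_le_quadratic hβ lam (p.A xh) (p.A (xh + t • (x - xh)))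
    rw [HR_eq, HR_eq] at h2
    have e1 : p.A (xh + t • (x - xh)) - p.A xh = t • p.A (x - xh) := by
      rw [← map_sub, add_sub_cancel_left, map_smul]
    have e2 : xh + t • (x - xh) - y = (xh - y) + t • (x - xh) := by abel
    rw [e1, inner_smul_right, norm_smul, mul_pow, Real.norm_eq_abs, sq_abs, ← hv] at h4
    rw [e2, norm_add_smul_sq] at h2
    have h5 : 0 ≤ t * ((p.fR x + p.gR x) - (p.fR xh + p.gR xh) + ⟪v, p.A (x - xh)⟫_ℝ
      + β * ⟪xh - y, x - xh⟫_ℝ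
      + t * (β⁻¹ / 2 * ‖p.A (x - xh)‖ ^ 2 + β / 2 * ‖x - xh‖ ^ 2)) := by
      linarith
    exact nonneg_of_mul_nonneg_right h5 h0
  rw [map_sub, inner_sub_right] at this
  linarith

/-- Joint quadratic growth of the inner objective. -/
theorem Admissible.HR_growth (hp : p.Admissible) (hβ : 0 < β) {y xh : Primal n}
    (hxh : xh ∈ effDom p.g) (hmin : ∀ w ∈ effDom p.g, p.HR y lam β xh ≤ p.HR y lam β w)
    {x : Primal n} (hx : x ∈ effDom p.g) :
    p.HR y lam β xh + β / 2 * (‖x - xh‖ ^ 2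
      + ‖p.Lam (p.A x) lam β - p.Lam (p.A xh) lam β‖ ^ 2) ≤ p.HR y lam β x := by
  have h1 := hp.prox_opt hβ hxh hmin hx
  -- The multiplier of `xh` is tested at `A x`: the slack of this strongly concave maximisation is
  -- the dual part of the growth.
  have h2 := hp.le_hs hβ (p.A x) lam (hp.lam_mem hβ (p.A xh) lam)
  rw [HR_eq, HR_eq, hp.hs_eq hβ (p.A xh) lam]
  rw [norm_sub_rev (p.Lam (p.A x) lam β)]
  have e : x - y = (xh - y) + (1 : ℝ) • (x - xh) := by module
  rw [e, norm_add_smul_sq]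
  linarith

/-- The exact proximal step does not move away from saddle points. -/
theorem Admissible.prox_nonexpansive (hp : p.Admissible) (hβ : 0 < β) {y xh : Primal n}
    (hxh : xh ∈ effDom p.g) (hmin : ∀ w ∈ effDom p.g, p.HR y lam β xh ≤ p.HR y lam β w)
    {xs : Primal n} {ls : Dual d₁ d₂} (hs : p.IsSaddle xs ls) :
    ‖xh - xs‖ ^ 2 + ‖p.Lam (p.A xh) lam β - ls‖ ^ 2 ≤ ‖y - xs‖ ^ 2 + ‖lam - ls‖ ^ 2 := by
  have h1 := hp.prox_opt hβ hxh hmin hs.primal_dom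
  have hpr := hp.isProx hβ (p.A xh) lam
  set v := p.Lam (p.A xh) lam β
  have h2 := hpr.hc_sub hp hs.dual_dom
  rw [hpr.z_eq, inner_sub_right, inner_smul_right] at h2
  have h3 := hp.le_hc hpr.mem_dom (z := p.A xs) hs.feasible
  rw [A_fst, hs.h_eq] at h3
  have h4 := hs.minimal xh hxh
  rw [inner_sub_left] at h2
  -- Optimality of `xh`, the subgradient inequality for `h*` at `v`, Fenchel–Young at `A xs` and
  -- minimality of `xs` add up to monotonicity of the saddle operator.
  have h5 : 0 ≤ β * (⟪xh - y, xs - xh⟫_ℝ + ⟪ls - v, v - lam⟫_ℝ) := by linarith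
  have h6 := nonneg_of_mul_nonneg_right h5 hβ
  have e1 : y - xs = (xh - xs) + (-1 : ℝ) • (xh - y) := by module
  have e2 : lam - ls = (v - ls) + (-1 : ℝ) • (v - lam) := by module
  have e3 : ⟪xh - y, xs - xh⟫_ℝ = -⟪xh - xs, xh - y⟫_ℝ := by
    rw [real_inner_comm, ← inner_neg_left]; congr 1; abel
  have e4 : ⟪ls - v, v - lam⟫_ℝ = -⟪v - ls, v - lam⟫_ℝ := by
    rw [← inner_neg_left]; congr 1; abel
  rw [e1, e2, norm_add_smul_sq, norm_add_smul_sq]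
  rw [e3, e4] at h6
  have := sq_nonneg ‖xh - y‖
  have := sq_nonneg ‖v - lam‖
  linarith

/-- Minkowski's inequality for pairs. -/
theorem sqrt_pair_add_le {E F : Type*} [NormedAddCommGroup E] [NormedAddCommGroup F]
    (a b : E) (c d : F) :
    √(‖a + b‖ ^ 2 + ‖c + d‖ ^ 2) ≤ √(‖a‖ ^ 2 + ‖c‖ ^ 2) + √(‖b‖ ^ 2 + ‖d‖ ^ 2) := by
  have key : ∀ (x : E) (y : F), √(‖x‖ ^ 2 + ‖y‖ ^ 2) = ‖WithLp.toLp 2 (x, y)‖ := by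
    intro x y
    rw [WithLp.prod_norm_eq_of_L2]
    rfl
  rw [key, key, key]
  exact norm_add_le (WithLp.toLp 2 (a, c)) (WithLp.toLp 2 (b, d))

/-- Distance to a saddle point after an inexact proximal step. -/
theorem Admissible.inexact_step (hp : p.Admissible) (hβ : 0 < β) {y x : Primal n} {e : ℝ}
    (hx : x ∈ effDom p.g) (hgap : ∀ w ∈ effDom p.g, p.HR y lam β x - p.HR y lam β w ≤ e)
    {xs : Primal n} {ls : Dual d₁ d₂} (hs : p.IsSaddle xs ls) :
    √(‖x - xs‖ ^ 2 + ‖p.Lam (p.A x) lam β - ls‖ ^ 2)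
      ≤ √(‖y - xs‖ ^ 2 + ‖lam - ls‖ ^ 2) + √(2 * e / β) := by
  obtain ⟨xh, hxh, hmin⟩ := hp.exists_min_HR hβ y lam
  have h1 := hp.HR_growth hβ hxh hmin hx
  have h2 := hgap xh hxh
  have h3 := hp.prox_nonexpansive hβ hxh hmin hs
  set v := p.Lam (p.A x) lam β
  set vh := p.Lam (p.A xh) lam β
  have h4 := sqrt_pair_add_le (xh - xs) (x - xh) (vh - ls) (v - vh)
  have e1 : xh - xs + (x - xh) = x - xs := by abel
  have e2 : vh - ls + (v - vh) = v - ls := by abel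
  rw [e1, e2] at h4
  have h5 : √(‖x - xh‖ ^ 2 + ‖v - vh‖ ^ 2) ≤ √(2 * e / β) := by
    apply Real.sqrt_le_sqrt
    rw [le_div_iff₀ hβ]
    linarith
  have h6 := Real.sqrt_le_sqrt h3
  linarith

/-- Warm start: the gap of an `e`-solution of one inner problem as a starting point for the
next. -/
theorem Admissible.warm_start (hp : p.Admissible) (hβ : 0 < β) {β' : ℝ} (hβ' : 0 < β')
    (hlt : β' ≤ β) (hgt : β < 2 * β') {y x : Primal n} {e : ℝ} (hx : x ∈ effDom p.g)
    (hgap : ∀ w ∈ effDom p.g, p.HR y lam β x - p.HR y lam β w ≤ e)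
    {w : Primal n} (hw : w ∈ effDom p.g) :
    p.HR x (p.Lam (p.A x) lam β) β' x - p.HR x (p.Lam (p.A x) lam β) β' w
      ≤ 2 * e + β * ‖p.Lam (p.A x) lam β - lam‖ ^ 2
        + (β - β') / 2
          * ‖p.Lam (p.A x) (p.Lam (p.A x) lam β) β' - p.Lam (p.A x) lam β‖ ^ 2
        + β ^ 2 / (2 * β' - β) * ‖y - x‖ ^ 2 := by
  set u := p.A x with hu
  set l' := p.Lam u lam β with hl'
  set l'' := p.Lam u l' β' with hl''
  -- The accuracy of `x` is used at the midpoint. Doubling that inequality produces `2 e` and only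
  -- `β / 4 ‖w - x‖²`, against the `β' / 2 ‖w - x‖²` of the new problem; the surplus is positive
  -- because `β < 2 β'`, and it absorbs the cross term in `x - y`.
  set xm := x + (1 / 2 : ℝ) • (w - x) with hxm
  have hxmD : xm ∈ effDom p.g := segment_mem hp.dom_convex hx hw (by norm_num) (by norm_num)
  have hG := ConvexOn.segment_le hp.fg_convexOn hx hw (t := 1 / 2) (by norm_num) (by norm_num)
  rw [← hxm] at hG
  have h1 := hgap xm hxmD
  rw [HR_eq, HR_eq, hp.hs_eq hβ (p.A xm) lam] at h1
  have hvm := hp.lam_mem hβ (p.A xm) lam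
  set vm := p.Lam (p.A xm) lam β
  have hAm : ⟪vm, p.A xm⟫_ℝ = ⟪vm, u⟫_ℝ + 1 / 2 * (⟪vm, p.A w⟫_ℝ - ⟪vm, u⟫_ℝ) := by
    rw [hxm, map_add, map_smul, map_sub, inner_add_right, inner_smul_right, inner_sub_right]
  -- The midpoint multiplier is a competitor both in the old problem at `u` and in the new one at `A
  -- w`. The terms in `‖vm - l'‖²` combine with the favourable sign of `β - β'`.
  have h2 := hp.le_hs hβ u lam hvm
  rw [← hl'] at h2
  have h3 := hp.le_hs hβ' (p.A w) l' hvm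
  -- Testing `l''` in the old problem controls the change of the smoothed value at `u` when `(lam,
  -- β)` becomes `(l', β')`.
  have h4 := hp.le_hs hβ u lam (hp.lam_mem hβ' u l')
  rw [← hl', ← hl''] at h4
  have h5 := hp.hs_eq hβ' u l'
  rw [← hl''] at h5
  rw [HR_eq, HR_eq, h5, sub_self, norm_zero]
  have e1 : xm - y = (x - y) + (1 / 2 : ℝ) • (w - x) := by rw [hxm]; abel
  rw [e1, norm_add_smul_sq] at h1
  have e2 : l'' - lam = (l'' - l') + (1 : ℝ) • (l' - lam) := by module
  rw [e2, norm_add_smul_sq] at h4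
  have h6 := real_inner_le_norm (l'' - l') (l' - lam)
  have h7 : ⟪l'' - l', l' - lam⟫_ℝ ≤ (‖l'' - l'‖ ^ 2 + ‖l' - lam‖ ^ 2) / 2 := by
    nlinarith [sq_nonneg (‖l'' - l'‖ - ‖l' - lam‖)]
  have h8 := mul_le_mul_of_nonneg_left h7 hβ.le
  have hD : 0 < 2 * β' - β := by linarith
  have h9 : β * ⟪x - y, w - x⟫_ℝ ≤ (2 * β' - β) / 4 * ‖w - x‖ ^ 2
      + β ^ 2 / (2 * β' - β) * ‖y - x‖ ^ 2 := by
    have h10 := mul_le_mul_of_nonneg_left (real_inner_le_norm (x - y) (w - x)) hβ.le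
    rw [norm_sub_rev x y] at h10
    have h11 : 0 ≤ (2 * β' - β) / 4 * (‖w - x‖ - 2 * β / (2 * β' - β) * ‖y - x‖) ^ 2 := by
      positivity
    have h12 : (2 * β' - β) / 4 * (‖w - x‖ - 2 * β / (2 * β' - β) * ‖y - x‖) ^ 2
        = (2 * β' - β) / 4 * ‖w - x‖ ^ 2 - β * (‖y - x‖ * ‖w - x‖)
          + β ^ 2 / (2 * β' - β) * ‖y - x‖ ^ 2 := by
      field_simp
      ring
    linarith
  have h13 : 0 ≤ β' / 2 * ‖vm - p.Lam (p.A w) l' β'‖ ^ 2 := by positivity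
  have h14 : 0 ≤ β / 2 * ‖vm - lam‖ ^ 2 := by positivity
  have h15 : 0 ≤ (β - β') / 2 * ‖vm - l'‖ ^ 2 :=
    mul_nonneg (by linarith) (sq_nonneg _)
  linarith

end Problem

variable {n d₁ d₂ : ℕ} {p : Problem n d₁ d₂} {q : Params n d₁ d₂}

/-! ### Invariants of the outer method -/

theorem sqrt_pow_eq {x : ℝ} (hx : 0 ≤ x) (s : ℕ) : √(x ^ s) = √x ^ s := by
  rw [Real.sqrt_eq_iff_mul_self_eq (by positivity) (by positivity), ← mul_pow,
    Real.mul_self_sqrt hx]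

namespace Params.Valid

theorem ρ_pos (hq : q.Valid p) : 0 < q.ρ := by linarith [hq.ρ_gt]

theorem β_pos (hq : q.Valid p) (s : ℕ) : 0 < q.β s := mul_pos hq.β₀_pos (pow_pos hq.ρ_pos s)

theorem ε_pos (hq : q.Valid p) (s : ℕ) : 0 < q.ε s := mul_pos hq.ε₀_pos (pow_pos hq.η_pos s)

theorem β_succ (q : Params n d₁ d₂) (s : ℕ) : q.β (s + 1) = q.ρ * q.β s := by
  simp only [Params.β, pow_succ]; ring

theorem ε_le (hq : q.Valid p) (s : ℕ) : q.ε s ≤ q.ε₀ * q.ρ ^ s := by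
  have := pow_le_pow_left₀ hq.η_pos.le hq.η_lt.le s
  exact mul_le_mul_of_nonneg_left this hq.ε₀_pos.le

theorem ratio_lt_one (hq : q.Valid p) : √(q.η / q.ρ) < 1 := by
  rw [Real.sqrt_lt' one_pos, one_pow, div_lt_one hq.ρ_pos]
  exact hq.η_lt

theorem sqrt_ratio (hq : q.Valid p) (s : ℕ) :
    √(2 * q.ε s / q.β s) = √(2 * (q.ε₀ / q.β₀)) * √(q.η / q.ρ) ^ s := by
  have h1 : 0 ≤ q.η / q.ρ := div_nonneg hq.η_pos.le hq.ρ_pos.le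
  have h2 : 2 * q.ε s / q.β s = 2 * (q.ε₀ / q.β₀) * (q.η / q.ρ) ^ s := by
    simp only [Params.ε, Params.β, div_pow]
    have := hq.β₀_pos.ne'
    have := (pow_pos hq.ρ_pos s).ne'
    field_simp
  rw [h2, Real.sqrt_mul' _ (by positivity), sqrt_pow_eq h1]

end Params.Valid

/-- The iterate `x^s` solves the inner problem of stage `s` to accuracy `ε_s`. -/
def StageGap (p : Problem n d₁ d₂) (q : Params n d₁ d₂) (s : ℕ) : Prop :=
  (run p q s).x ∈ effDom p.g ∧ ∀ w ∈ effDom p.g,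
    p.HR (run p q s).xPrev (run p q s).lam (q.β s) (run p q s).x
      - p.HR (run p q s).xPrev (run p q s).lam (q.β s) w ≤ q.ε s

/-- The multiplier `λ^{s+1}`. -/
def nextLam (p : Problem n d₁ d₂) (q : Params n d₁ d₂) (s : ℕ) : Dual d₁ d₂ :=
  p.Lam (p.A (run p q s).x) (run p q s).lam (q.β s)

theorem run_succ_xPrev (s : ℕ) : (run p q (s + 1)).xPrev = (run p q s).x := rfl

theorem run_succ_lam (s : ℕ) : (run p q (s + 1)).lam = nextLam p q s := rfl

theorem run_succ_m (s : ℕ) : (run p q (s + 1)).m = sInf {m : ℕ | 0 < m ∧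
    EnoughInner p q s (run p q s).xPrev (run p q s).x (run p q s).lam (nextLam p q s) m} := rfl

theorem stageGap_zero (hp : p.Admissible) (hq : q.Valid p) : StageGap p q 0 := by
  have hβ := hq.β_pos 0
  obtain ⟨z, hz, hmin⟩ := hp.exists_min_HR hβ q.xInit q.lamInit
  have hx : (run p q 0).x ∈ effDom p.g :=
    (hp.innerSolver_gap hβ q.xInit q.lamInit hq.xInit_dom
      (B := p.HR q.xInit q.lamInit (q.β 0) q.xInit - p.HR q.xInit q.lamInit (q.β 0) z)
      (fun w hw => by linarith [hmin w hw]) q.m₀).1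
  refine ⟨hx, fun w hw => ?_⟩
  have h1 : p.H q.xInit q.lamInit (q.β 0) (run p q 0).x
      ≤ p.H q.xInit q.lamInit (q.β 0) w + (q.ε₀ : EReal) :=
    hq.ε₀_ge.trans (add_le_add_left (iInf_le _ w) _)
  rw [hp.H_eq hβ _ _ hx, hp.H_eq hβ _ _ hw] at h1
  have h2 : p.HR q.xInit q.lamInit (q.β 0) (run p q 0).x
    ≤ p.HR q.xInit q.lamInit (q.β 0) w + q.ε₀ := by exact_mod_cast h1
  have h3 : q.ε 0 = q.ε₀ := by simp [Params.ε]
  rw [h3]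
  show p.HR q.xInit q.lamInit (q.β 0) (run p q 0).x - p.HR q.xInit q.lamInit (q.β 0) w ≤ q.ε₀
  linarith

/-- The bound that the termination test compares with `2 ^ (m / N) ε_{s+1} / 2`. -/
def testBound (p : Problem n d₁ d₂) (q : Params n d₁ d₂) (s : ℕ) (xp x : Primal n)
    (lam lam' : Dual d₁ d₂) : ℝ :=
  2 * q.ε s + q.β s * ‖lam' - lam‖ ^ 2
    + (q.β s - q.β (s + 1)) / 2 * ‖p.Lam (p.A x) lam' (q.β (s + 1)) - lam'‖ ^ 2
    + q.β s ^ 2 / (2 * q.β (s + 1) - q.β s) * ‖xp - x‖ ^ 2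
    + ‖lam' - lam‖ * √(((q.β s + q.β (s + 1)) * p.Lh
          + ‖q.β s • lam.fst - q.β (s + 1) • lam'.fst‖) ^ 2
        + ‖q.β s • lam.snd - q.β (s + 1) • lam'.snd‖ ^ 2)

theorem enoughInner_iff {s : ℕ} {xp x : Primal n} {lam lam' : Dual d₁ d₂} {m : ℕ} :
    EnoughInner p q s xp x lam lam' m ↔ testBound p q s xp x lam lam'
      ≤ 2 ^ (m / p.N (q.β (s + 1))) * (q.ε (s + 1) / 2) := Iff.rfl

theorem enoughInner_mul (hp : p.Admissible) (hq : q.Valid p) {s : ℕ} {xp x : Primal n}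
    {lam lam' : Dual d₁ d₂} {j : ℕ} (hj : 0 < j)
    (h : testBound p q s xp x lam lam' ≤ 2 ^ j * (q.ε (s + 1) / 2)) :
    0 < p.N (q.β (s + 1)) * j ∧
      EnoughInner p q s xp x lam lam' (p.N (q.β (s + 1)) * j) := by
  have hN := hp.N_pos (hq.β_pos (s + 1))
  refine ⟨Nat.mul_pos hN hj, ?_⟩
  rw [enoughInner_iff, Nat.mul_div_cancel_left _ hN]
  exact h

theorem run_m_le (hp : p.Admissible) (hq : q.Valid p) {s j : ℕ} (hj : 0 < j)
    (h : testBound p q s (run p q s).xPrev (run p q s).x (run p q s).lam (nextLam p q s)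
      ≤ 2 ^ j * (q.ε (s + 1) / 2)) : (run p q (s + 1)).m ≤ p.N (q.β (s + 1)) * j := by
  rw [run_succ_m]
  exact Nat.sInf_le (enoughInner_mul hp hq hj h)

/-- The infimum belongs to the set of admissible counts only if that set is nonempty; multiples of
the restart period reach arbitrarily large powers of two. -/
theorem enoughInner_run (hp : p.Admissible) (hq : q.Valid p) (s : ℕ) :
    EnoughInner p q s (run p q s).xPrev (run p q s).x (run p q s).lam (nextLam p q s)
      (run p q (s + 1)).m := by
  rw [run_succ_m]
  refine (Nat.sInf_mem (s := {m : ℕ | 0 < m ∧ EnoughInner p q s (run p q s).xPrev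
    (run p q s).x (run p q s).lam (nextLam p q s) m}) ?_).2
  set B := testBound p q s (run p q s).xPrev (run p q s).x (run p q s).lam (nextLam p q s)
  have hε := hq.ε_pos (s + 1)
  obtain ⟨j, hj⟩ := pow_unbounded_of_one_lt (B / (q.ε (s + 1) / 2)) (one_lt_two : (1 : ℝ) < 2)
  refine ⟨_, enoughInner_mul hp hq (Nat.succ_pos j) ?_⟩
  rw [div_lt_iff₀ (by positivity)] at hj
  refine hj.le.trans (mul_le_mul_of_nonneg_right ?_ (by positivity))
  exact pow_le_pow_right₀ one_le_two (Nat.le_succ j)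

/-- The tested quantity is the warm-start bound plus a nonnegative product, so passing the test
means that the completed periods bring the gap below `ε_{s+1} / 2`. -/
theorem stageGap_succ (hp : p.Admissible) (hq : q.Valid p) {s : ℕ} (h : StageGap p q s) :
    StageGap p q (s + 1) := by
  have hβ := hq.β_pos s
  have hβ' := hq.β_pos (s + 1)
  have hsucc := Params.Valid.β_succ q s
  have hε := hq.ε_pos (s + 1)
  have hle : q.β (s + 1) ≤ q.β s := by
    rw [hsucc]; nlinarith [hq.ρ_lt]
  have hlt : q.β s < 2 * q.β (s + 1) := by
    rw [hsucc]; nlinarith [hq.ρ_gt]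
  have hwarm : ∀ w ∈ effDom p.g,
      p.HR (run p q s).x (nextLam p q s) (q.β (s + 1)) (run p q s).x
        - p.HR (run p q s).x (nextLam p q s) (q.β (s + 1)) w
        ≤ testBound p q s (run p q s).xPrev (run p q s).x (run p q s).lam (nextLam p q s) := by
    intro w hw
    refine (hp.warm_start hβ hβ' hle hlt h.1 h.2 hw).trans ?_
    refine le_add_of_nonneg_right ?_
    positivity
  have hgap := hp.innerSolver_gap hβ' (run p q s).x (nextLam p q s) h.1 hwarm
    (run p q (s + 1)).m
  refine ⟨hgap.1, fun w hw => (hgap.2 w hw).trans ?_⟩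
  rw [div_le_iff₀ (by positivity)]
  have h1 := enoughInner_iff.1 (enoughInner_run hp hq s)
  have h2 : (0 : ℝ) < 2 ^ ((run p q (s + 1)).m / p.N (q.β (s + 1))) := by positivity
  nlinarith

theorem stageGap (hp : p.Admissible) (hq : q.Valid p) (s : ℕ) : StageGap p q s := by
  induction s with
  | zero => exact stageGap_zero hp hq
  | succ s ih => exact stageGap_succ hp hq ih

/-! ### Boundedness of the iterates -/

section Bounds

variable {xs : Primal n} {ls : Dual d₁ d₂}

theorem dist_saddle_le (hp : p.Admissible) (hq : q.Valid p) (hs : p.IsSaddle xs ls) (s : ℕ) :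
    √(‖(run p q s).xPrev - xs‖ ^ 2 + ‖(run p q s).lam - ls‖ ^ 2)
      ≤ √(‖q.xInit - xs‖ ^ 2 + ‖q.lamInit - ls‖ ^ 2)
        + 2 * √(q.ε₀ / q.β₀) / (1 - √(q.η / q.ρ)) := by
  set r := √(q.η / q.ρ) with hr
  have hr1 : r < 1 := hq.ratio_lt_one
  have hr0 : 0 ≤ r := Real.sqrt_nonneg _
  set a := √(2 * (q.ε₀ / q.β₀)) with ha
  have ha0 : 0 ≤ a := Real.sqrt_nonneg _
  have hsub : 0 < 1 - r := by linarith
  -- The geometric tail `a r^s / (1 - r)` acts as a potential: its decrease pays for the error `a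
  -- r^s` of the stage.
  have key : ∀ s : ℕ, √(‖(run p q s).xPrev - xs‖ ^ 2 + ‖(run p q s).lam - ls‖ ^ 2)
      + a * r ^ s / (1 - r)
      ≤ √(‖q.xInit - xs‖ ^ 2 + ‖q.lamInit - ls‖ ^ 2) + a / (1 - r) := by
    intro s
    induction s with
    | zero => simp [run]
    | succ s ih =>
      have h1 := hp.inexact_step (hq.β_pos s) (stageGap hp hq s).1 (stageGap hp hq s).2 hs
      rw [hq.sqrt_ratio s, ← ha, ← hr] at h1
      rw [run_succ_xPrev, run_succ_lam]
      have h2 : a * r ^ s + a * r ^ (s + 1) / (1 - r) = a * r ^ s / (1 - r) := by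
        field_simp
        ring
      unfold nextLam
      linarith
  have h1 := key s
  have h2 : 0 ≤ a * r ^ s / (1 - r) := by positivity
  have h3 : a ≤ 2 * √(q.ε₀ / q.β₀) := by
    have h0 : 0 ≤ q.ε₀ / q.β₀ := div_nonneg hq.ε₀_pos.le hq.β₀_pos.le
    rw [ha, Real.sqrt_le_left (by positivity), mul_pow, Real.sq_sqrt h0]
    linarith
  have h4 : a / (1 - r) ≤ 2 * √(q.ε₀ / q.β₀) / (1 - r) :=
    div_le_div_of_nonneg_right h3 hsub.le
  linarith

/-- A uniform bound on iterates, multipliers and their displacements. -/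
def radius (q : Params n d₁ d₂) (xs : Primal n) (ls : Dual d₁ d₂) : ℝ := √(2 * c₀ q xs ls)

theorem c₀_nonneg (q : Params n d₁ d₂) (xs : Primal n) (ls : Dual d₁ d₂) :
    0 ≤ c₀ q xs ls := by
  unfold c₀; positivity

theorem radius_nonneg (q : Params n d₁ d₂) (xs : Primal n) (ls : Dual d₁ d₂) :
    0 ≤ radius q xs ls := Real.sqrt_nonneg _

theorem radius_sq (q : Params n d₁ d₂) (xs : Primal n) (ls : Dual d₁ d₂) :
    radius q xs ls ^ 2 = 2 * c₀ q xs ls :=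
  Real.sq_sqrt (by have := c₀_nonneg q xs ls; positivity)

/-- Half the radius is enough because `radius² / 4 = c₀ / 2` dominates the squared distance bound.
The halves then make differences of consecutive points at most one radius. -/
theorem dist_saddle_le_radius (hp : p.Admissible) (hq : q.Valid p) (hs : p.IsSaddle xs ls)
    (s : ℕ) : ‖(run p q s).xPrev - xs‖ ≤ radius q xs ls / 2
      ∧ ‖(run p q s).lam - ls‖ ≤ radius q xs ls / 2 := by
  have h1 := dist_saddle_le hp hq hs s
  have h2 := pow_le_pow_left₀ (Real.sqrt_nonneg _) h1 2
  rw [Real.sq_sqrt (by positivity)] at h2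
  have h3 := radius_sq q xs ls
  have h4 := radius_nonneg q xs ls
  have h5 : ‖(run p q s).xPrev - xs‖ ^ 2 + ‖(run p q s).lam - ls‖ ^ 2
      ≤ (radius q xs ls / 2) ^ 2 := by
    have h6 : c₀ q xs ls = 2 * (√(‖q.xInit - xs‖ ^ 2 + ‖q.lamInit - ls‖ ^ 2)
        + 2 * √(q.ε₀ / q.β₀) / (1 - √(q.η / q.ρ))) ^ 2 + 2 * ‖ls‖ ^ 2 + 2 * ‖xs‖ ^ 2 := rfl
    have := sq_nonneg ‖ls‖
    have := sq_nonneg ‖xs‖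
    rw [div_pow, h3, h6]
    linarith
  constructor
  · exact (abs_le_of_sq_le_sq' (by linarith [sq_nonneg ‖(run p q s).lam - ls‖])
      (by positivity)).2
  · exact (abs_le_of_sq_le_sq' (by linarith [sq_nonneg ‖(run p q s).xPrev - xs‖])
      (by positivity)).2

theorem norm_ls_le_radius (q : Params n d₁ d₂) (xs : Primal n) (ls : Dual d₁ d₂) :
    ‖ls‖ ≤ radius q xs ls / 2 := by
  refine (abs_le_of_sq_le_sq' ?_ (by have := radius_nonneg q xs ls; positivity)).2
  rw [div_pow, radius_sq]
  unfold c₀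
  have := sq_nonneg ‖xs‖
  have := sq_nonneg (√(‖q.xInit - xs‖ ^ 2 + ‖q.lamInit - ls‖ ^ 2)
        + 2 * √(q.ε₀ / q.β₀) / (1 - √(q.η / q.ρ)))
  linarith

theorem norm_lam_le (hp : p.Admissible) (hq : q.Valid p) (hs : p.IsSaddle xs ls) (s : ℕ) :
    ‖(run p q s).lam‖ ≤ radius q xs ls := by
  have h1 := (dist_saddle_le_radius hp hq hs s).2
  have h2 := norm_ls_le_radius q xs ls
  have h3 := norm_le_norm_add_norm_sub' (run p q s).lam ls
  linarith

theorem norm_nextLam_sub_le (hp : p.Admissible) (hq : q.Valid p) (hs : p.IsSaddle xs ls)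
    (s : ℕ) : ‖nextLam p q s - (run p q s).lam‖ ≤ radius q xs ls := by
  have h1 := (dist_saddle_le_radius hp hq hs s).2
  have h2 := (dist_saddle_le_radius hp hq hs (s + 1)).2
  rw [run_succ_lam] at h2
  have h3 := norm_sub_le_norm_sub_add_norm_sub (nextLam p q s) ls (run p q s).lam
  rw [norm_sub_rev ls] at h3
  linarith

theorem norm_x_sub_le (hp : p.Admissible) (hq : q.Valid p) (hs : p.IsSaddle xs ls)
    (s : ℕ) : ‖(run p q s).xPrev - (run p q s).x‖ ≤ radius q xs ls := by
  have h1 := (dist_saddle_le_radius hp hq hs s).1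
  have h2 := (dist_saddle_le_radius hp hq hs (s + 1)).1
  rw [run_succ_xPrev] at h2
  have h3 := norm_sub_le_norm_sub_add_norm_sub (run p q s).xPrev xs (run p q s).x
  rw [norm_sub_rev xs] at h3
  linarith

/-- The quantity in the termination test is of order `ρ ^ s`. -/
theorem testBound_le (hp : p.Admissible) (hq : q.Valid p) (hs : p.IsSaddle xs ls) (s : ℕ) :
    testBound p q s (run p q s).xPrev (run p q s).x (run p q s).lam (nextLam p q s)
      ≤ (2 * q.ε₀ + q.β₀ * (8 * radius q xs ls ^ 2 + radius q xs ls ^ 2 / (2 * q.ρ - 1)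
        + p.Lh ^ 2)) * q.ρ ^ s := by
  set D := radius q xs ls
  have hD : 0 ≤ D := radius_nonneg q xs ls
  have hβ := hq.β_pos s
  have hsucc := Params.Valid.β_succ q s
  have hβ' := hq.β_pos (s + 1)
  have hρ0 := hq.ρ_pos
  have hρ1 := hq.ρ_lt
  have hρ2 := hq.ρ_gt
  have hLh := hp.Lh_nonneg
  have hlam := norm_lam_le hp hq hs s
  have hlam' := norm_lam_le hp hq hs (s + 1)
  rw [run_succ_lam] at hlam'
  have hq1 := norm_nextLam_sub_le hp hq hs s
  have hx := norm_x_sub_le hp hq hs s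
  have hle : q.β (s + 1) ≤ q.β s := by rw [hsucc]; nlinarith
  have hstep := hp.norm_lam_sub_le hβ hβ' (p.A (run p q s).x) (run p q s).lam
  change _ ≤ q.β s * ‖nextLam p q s - (run p q s).lam‖ at hstep
  change q.β (s + 1) * ‖p.Lam (p.A (run p q s).x) (nextLam p q s) (q.β (s + 1))
    - nextLam p q s‖ ≤ _ at hstep
  unfold testBound
  set l := (run p q s).lam
  set l' := nextLam p q s
  set P := ‖p.Lam (p.A (run p q s).x) l' (q.β (s + 1)) - l'‖
  set b := q.β s with hb
  set b' := q.β (s + 1)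
  have hP0 : 0 ≤ P := norm_nonneg _
  -- `norm_lam_sub_le` costs a factor `β_s / β_{s+1} = 1 / ρ`, which is less than 2.
  have hP : P ≤ 2 * D := by
    have h1 : b * ‖l' - l‖ ≤ b * D := mul_le_mul_of_nonneg_left hq1 hβ.le
    have h2 : q.ρ * P ≤ D := by
      have h3 : b * (q.ρ * P) ≤ b * D := by
        have : b * (q.ρ * P) = b' * P := by rw [hsucc]; ring
        linarith
      exact le_of_mul_le_mul_left h3 hβ
    nlinarith
  have t1 : b * ‖l' - l‖ ^ 2 ≤ b * D ^ 2 := by gcongr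
  have t2 : (b - b') / 2 * P ^ 2 ≤ b * D ^ 2 := by
    have h1 : P ^ 2 ≤ 4 * D ^ 2 := by
      have := pow_le_pow_left₀ hP0 hP 2
      linarith
    have h2 : (b - b') ≤ b / 2 := by rw [hsucc]; nlinarith
    have h3 : (b - b') / 2 * P ^ 2 ≤ (b / 2) / 2 * P ^ 2 := by gcongr
    have h4 : (b / 2) / 2 * P ^ 2 ≤ (b / 2) / 2 * (4 * D ^ 2) := by gcongr
    linarith
  have t3 : b ^ 2 / (2 * b' - b) * ‖(run p q s).xPrev - (run p q s).x‖ ^ 2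
      ≤ b * (D ^ 2 / (2 * q.ρ - 1)) := by
    have h1 : b ^ 2 / (2 * b' - b) = b / (2 * q.ρ - 1) := by
      have h2 : 2 * b' - b = b * (2 * q.ρ - 1) := by rw [hsucc]; ring
      have h3 : 2 * q.ρ - 1 ≠ 0 := by
        intro h; linarith
      rw [h2]
      field_simp
    have h4 : 0 < 2 * q.ρ - 1 := by linarith
    rw [h1]
    calc b / (2 * q.ρ - 1) * ‖(run p q s).xPrev - (run p q s).x‖ ^ 2
        ≤ b / (2 * q.ρ - 1) * D ^ 2 := by gcongr
      _ = b * (D ^ 2 / (2 * q.ρ - 1)) := by ring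
  have hfst : ‖b • l.fst - b' • l'.fst‖ ≤ 2 * (b * D) := by
    have h1 := norm_sub_le (b • l.fst) (b' • l'.fst)
    rw [norm_smul, norm_smul, Real.norm_eq_abs, Real.norm_eq_abs, abs_of_pos hβ,
      abs_of_pos hβ'] at h1
    have h2 : b * ‖l.fst‖ ≤ b * D :=
      mul_le_mul_of_nonneg_left ((Problem.norm_fst_le l).trans hlam) hβ.le
    have h3 : b' * ‖l'.fst‖ ≤ b * D :=
      mul_le_mul hle ((Problem.norm_fst_le l').trans hlam') (norm_nonneg _) hβ.le
    linarith
  have hsnd : ‖b • l.snd - b' • l'.snd‖ ≤ 2 * (b * D) := by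
    have h1 := norm_sub_le (b • l.snd) (b' • l'.snd)
    rw [norm_smul, norm_smul, Real.norm_eq_abs, Real.norm_eq_abs, abs_of_pos hβ,
      abs_of_pos hβ'] at h1
    have h2 : b * ‖l.snd‖ ≤ b * D :=
      mul_le_mul_of_nonneg_left ((Problem.norm_snd_le l).trans hlam) hβ.le
    have h3 : b' * ‖l'.snd‖ ≤ b * D :=
      mul_le_mul hle ((Problem.norm_snd_le l').trans hlam') (norm_nonneg _) hβ.le
    linarith
  have hsqrt : √(((b + b') * p.Lh + ‖b • l.fst - b' • l'.fst‖) ^ 2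
      + ‖b • l.snd - b' • l'.snd‖ ^ 2) ≤ b * (2 * p.Lh + 4 * D) := by
    have h1 : (b + b') * p.Lh ≤ 2 * b * p.Lh := by gcongr; linarith
    have h0 : 0 ≤ (b + b') * p.Lh := by positivity
    rw [Real.sqrt_le_left (by positivity)]
    set X := (b + b') * p.Lh + ‖b • l.fst - b' • l'.fst‖
    set Y := ‖b • l.snd - b' • l'.snd‖
    have hX : 0 ≤ X := add_nonneg h0 (norm_nonneg _)
    have hY : 0 ≤ Y := norm_nonneg _
    have h2 : X + Y ≤ b * (2 * p.Lh + 4 * D) := by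
      simp only [X]; linarith
    have h3 := pow_le_pow_left₀ (add_nonneg hX hY) h2 2
    nlinarith [mul_nonneg hX hY]
  have t4 : ‖l' - l‖ * √(((b + b') * p.Lh + ‖b • l.fst - b' • l'.fst‖) ^ 2
      + ‖b • l.snd - b' • l'.snd‖ ^ 2) ≤ D * (b * (2 * p.Lh + 4 * D)) :=
    mul_le_mul hq1 hsqrt (Real.sqrt_nonneg _) hD
  have t5 : D * (b * (2 * p.Lh + 4 * D)) ≤ b * (5 * D ^ 2 + p.Lh ^ 2) := by
    have h1 : 2 * (D * p.Lh) ≤ D ^ 2 + p.Lh ^ 2 := by nlinarith [sq_nonneg (D - p.Lh)]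
    have h2 := mul_le_mul_of_nonneg_left h1 hβ.le
    linarith
  have hε := hq.ε_le s
  have hfin : b * (7 * D ^ 2 + D ^ 2 / (2 * q.ρ - 1) + p.Lh ^ 2)
      ≤ b * (8 * D ^ 2 + D ^ 2 / (2 * q.ρ - 1) + p.Lh ^ 2) := by
    have := sq_nonneg D
    gcongr
    norm_num
  have hbs : q.β₀ * (8 * D ^ 2 + D ^ 2 / (2 * q.ρ - 1) + p.Lh ^ 2) * q.ρ ^ s
      = b * (8 * D ^ 2 + D ^ 2 / (2 * q.ρ - 1) + p.Lh ^ 2) := by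
    rw [hb, Params.β]; ring
  rw [add_mul (2 * q.ε₀), hbs]
  linarith

end Bounds

variable {xs : Primal n} {ls : Dual d₁ d₂}

/-! ### Accuracy of the iterates -/

/-- Lower bound on the objective through the multiplier. -/
theorem Problem.IsSaddle.le_add (hp : p.Admissible) (hs : p.IsSaddle xs ls) {x : Primal n}
    (hx : x ∈ effDom p.g) {k : EuclideanSpace ℝ (Fin d₂)} (hk : k ∈ p.K) :
    p.fR xs + p.gR xs + p.h₁ (p.A₁ xs)
      ≤ p.fR x + p.gR x + p.h₁ (p.A₁ x) + ‖ls‖ * ‖p.A₂ x - k‖ := by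
  have h1 := hs.minimal x hx
  -- Fenchel–Young at `(A₁ x; k)` leaves only the second block of the multiplier to pay for
  -- infeasibility.
  have h2 := hp.le_hc hs.dual_dom (z := WithLp.toLp 2 (p.A₁ x, k)) hk
  have h3 : ⟪ls, p.A x⟫_ℝ - ⟪ls, WithLp.toLp 2 (p.A₁ x, k)⟫_ℝ
      = ⟪ls.snd, p.A₂ x - k⟫_ℝ := by
    rw [WithLp.prod_inner_apply, WithLp.prod_inner_apply, inner_sub_right]
    show ⟪ls.fst, p.A₁ x⟫_ℝ + ⟪ls.snd, p.A₂ x⟫_ℝ - (⟪ls.fst, p.A₁ x⟫_ℝ + ⟪ls.snd, k⟫_ℝ) = _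
    ring
  have h4 := real_inner_le_norm ls.snd (p.A₂ x - k)
  have h5 := mul_le_mul_of_nonneg_right (Problem.norm_snd_le ls) (norm_nonneg (p.A₂ x - k))
  have h6 := hs.h_eq
  have h7 : p.h₁ (WithLp.toLp 2 (p.A₁ x, k)).fst = p.h₁ (p.A₁ x) := rfl
  rw [h7] at h2
  linarith

/-- For feasible `x` in `dom g`, the multiplier bound with `k = A₂ x` has no infeasibility term.
Outside `dom g` the objective is `⊤`, since `f` is never `⊥`. -/
theorem Problem.IsSaddle.fStar_eq (hp : p.Admissible) (hs : p.IsSaddle xs ls) :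
    p.FStar = ((p.fR xs + p.gR xs + p.h₁ (p.A₁ xs) : ℝ) : EReal) := by
  rw [← hp.F_eq hs.primal_dom]
  refine le_antisymm (iInf₂_le xs hs.feasible) (le_iInf₂ fun x hx => ?_)
  by_cases hxD : x ∈ effDom p.g
  · rw [hp.F_eq hs.primal_dom, hp.F_eq hxD]
    have h := hs.le_add hp hxD (k := p.A₂ x) hx
    rw [sub_self, norm_zero, mul_zero, add_zero] at h
    exact_mod_cast h
  · have h1 : p.g x = ⊤ := by
      by_contra h
      exact hxD (lt_top_iff_ne_top.2 h)
    have h2 : p.F x = ⊤ := by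
      rw [Problem.F, h1, EReal.add_top_of_ne_bot (hp.f_ne_bot x), EReal.top_add_coe]
    rw [h2]
    exact le_top

/-- The proximal point `z` is in `dom h` and within `β_s D` of `A x^s`. The upper bound compares the
values of `H_s` at `x^s` and `xs`, then passes from `z` to `A₁ x^s` by Lipschitz continuity; the
lower bound uses the multiplier with `k = z.snd`. -/
theorem isEpsSolution_run (hp : p.Admissible) (hq : q.Valid p) (hs : p.IsSaddle xs ls) (s : ℕ)
    {ε : ℝ} (h1 : (q.ε₀ + q.β₀ * (3 * radius q xs ls ^ 2 + p.Lh ^ 2)) * q.ρ ^ s ≤ ε)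
    (h2 : q.β₀ * radius q xs ls * q.ρ ^ s ≤ ε) : p.IsEpsSolution ε (run p q s).x := by
  obtain ⟨hx, hgap⟩ := stageGap hp hq s
  have hβ := hq.β_pos s
  have hpr := hp.isProx hβ (p.A (run p q s).x) (run p q s).lam
  have henv := hp.hs_eq_prox hβ (p.A (run p q s).x) (run p q s).lam
  have hD : 0 ≤ radius q xs ls := radius_nonneg q xs ls
  have hxs := hgap xs hs.primal_dom
  have hdist := (dist_saddle_le_radius hp hq hs s).1
  have hlam := norm_lam_le hp hq hs s
  have hq1 := norm_nextLam_sub_le hp hq hs s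
  have hls := norm_ls_le_radius q xs ls
  have hε := hq.ε_le s
  change p.IsProx _ _ _ _ (nextLam p q s) at hpr
  set x := (run p q s).x
  set y := (run p q s).xPrev
  set l := (run p q s).lam
  set D := radius q xs ls
  set z := p.proxPt (p.A x) l (q.β s)
  set b := q.β s with hb
  have hbs : b = q.β₀ * q.ρ ^ s := rfl
  have hu : ‖p.A x - z‖ ≤ b * D := by
    rw [← hpr.eq, norm_smul, Real.norm_eq_abs, abs_of_pos hβ]
    exact mul_le_mul_of_nonneg_left hq1 hβ.le
  have hu2 : ‖p.A₂ x - z.snd‖ ≤ b * D := (Problem.norm_snd_le (p.A x - z)).trans hu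
  have hu1 : ‖p.A₁ x - z.fst‖ ≤ b * D := (Problem.norm_fst_le (p.A x - z)).trans hu
  have hup : p.fR x + p.gR x + p.h₁ (p.A₁ x) ≤ p.fR xs + p.gR xs + p.h₁ (p.A₁ xs) + ε := by
    rw [Problem.HR_eq, Problem.HR_eq] at hxs
    have t1 := hp.hs_le hβ (p.A xs) l (z := p.A xs) hs.feasible
    rw [sub_self, inner_zero_right, norm_zero, Problem.A_fst] at t1
    have t2 : ‖xs - y‖ ^ 2 ≤ D ^ 2 := by
      rw [norm_sub_rev]
      exact pow_le_pow_left₀ (norm_nonneg _) (by linarith) 2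
    have t3 : b / 2 * ‖xs - y‖ ^ 2 ≤ b / 2 * D ^ 2 := by gcongr
    have t4 : 0 ≤ b / 2 * ‖x - y‖ ^ 2 := by positivity
    have t5 : 0 ≤ b / 2 * ‖p.Lam (p.A x) l b - l‖ ^ 2 := by positivity
    have t6 := (abs_le.1 (hp.h₁_lipschitz (p.A₁ x) z.fst)).2
    have t7 := mul_le_mul_of_nonneg_left hu1 hp.Lh_nonneg
    have t8 := (abs_le.1 (abs_real_inner_le_norm l (p.A x - z))).1
    have t9 : ‖l‖ * ‖p.A x - z‖ ≤ D * (b * D) := mul_le_mul hlam hu (norm_nonneg _) hD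
    have t10 : p.Lh * (b * D) ≤ b * (p.Lh ^ 2 / 2 + D ^ 2 / 2) := by
      nlinarith [sq_nonneg (p.Lh - D)]
    have t11 : 0 ≤ b * D ^ 2 := by positivity
    have t12 : 0 ≤ b * p.Lh ^ 2 := by positivity
    have t13 : (q.ε₀ + q.β₀ * (3 * D ^ 2 + p.Lh ^ 2)) * q.ρ ^ s
        = q.ε₀ * q.ρ ^ s + b * (3 * D ^ 2 + p.Lh ^ 2) := by rw [hbs]; ring
    linarith
  have hlow : p.fR xs + p.gR xs + p.h₁ (p.A₁ xs) ≤ p.fR x + p.gR x + p.h₁ (p.A₁ x) + ε := by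
    have t1 := hs.le_add hp hx (k := z.snd) hpr.mem
    have t2 : ‖ls‖ * ‖p.A₂ x - z.snd‖ ≤ D * (b * D) :=
      mul_le_mul (by linarith) hu2 (norm_nonneg _) hD
    have t11 : 0 ≤ b * D ^ 2 := by positivity
    have t12 : 0 ≤ b * p.Lh ^ 2 := by positivity
    have t13 : (q.ε₀ + q.β₀ * (3 * D ^ 2 + p.Lh ^ 2)) * q.ρ ^ s
        = q.ε₀ * q.ρ ^ s + b * (3 * D ^ 2 + p.Lh ^ 2) := by rw [hbs]; ring
    have t14 : 0 ≤ q.ε₀ * q.ρ ^ s :=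
      mul_nonneg hq.ε₀_pos.le (pow_pos hq.ρ_pos s).le
    linarith
  refine ⟨hx, ?_, ?_, ?_⟩
  · rw [hs.fStar_eq hp, hp.F_eq hx]
    exact_mod_cast hup
  · rw [hs.fStar_eq hp, hp.F_eq hx]
    exact_mod_cast hlow
  · refine (Metric.infDist_le_dist_of_mem hpr.mem).trans ?_
    rw [dist_eq_norm]
    refine hu2.trans (le_trans (le_of_eq ?_) h2)
    rw [hbs]; ring

/-! ### The constants -/

theorem c₁_ge (p : Problem n d₁ d₂) (q : Params n d₁ d₂) (xs : Primal n) (ls : Dual d₁ d₂) :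
    q.ε₀ + 2 * p.Lh ^ 2 * q.β₀ + c₀ q xs ls * q.β₀ ≤ c₁ p q xs ls := le_max_left _ _

theorem c₁_ge_sqrt (p : Problem n d₁ d₂) (q : Params n d₁ d₂) (xs : Primal n)
    (ls : Dual d₁ d₂) : q.β₀ * √(c₀ q xs ls) ≤ c₁ p q xs ls :=
  (le_max_right _ _).trans (le_max_right _ _)

theorem ε₀_le_c₁ (hq : q.Valid p) : q.ε₀ ≤ c₁ p q xs ls := by
  have h1 := c₁_ge p q xs ls
  have h2 : 0 ≤ c₀ q xs ls * q.β₀ := mul_nonneg (c₀_nonneg q xs ls) hq.β₀_pos.le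
  have h3 : 0 ≤ 2 * p.Lh ^ 2 * q.β₀ := mul_nonneg (by positivity) hq.β₀_pos.le
  linarith

/-- The factor 7 is generous: `3 radius²` equals `6 c₀`, and `radius ≤ 2 √c₀`. -/
theorem isEpsSolution_of_c₁ (hp : p.Admissible) (hq : q.Valid p) (hs : p.IsSaddle xs ls)
    {s : ℕ} {ε : ℝ} (h : 7 * c₁ p q xs ls * q.ρ ^ s ≤ ε) :
    p.IsEpsSolution ε (run p q s).x := by
  have h1 := c₁_ge p q xs ls
  have h2 := c₁_ge_sqrt p q xs ls
  have hc := c₀_nonneg q xs ls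
  have hβ := hq.β₀_pos
  have hε := hq.ε₀_pos
  have hρ := (pow_pos hq.ρ_pos s).le
  have h3 : 0 ≤ c₀ q xs ls * q.β₀ := by positivity
  have h4 : 0 ≤ p.Lh ^ 2 * q.β₀ := by positivity
  refine isEpsSolution_run hp hq hs s (le_trans ?_ h) (le_trans ?_ h)
  · refine mul_le_mul_of_nonneg_right ?_ hρ
    rw [radius_sq]
    linarith
  · refine mul_le_mul_of_nonneg_right ?_ hρ
    have h5 : radius q xs ls ≤ 2 * √(c₀ q xs ls) := by
      rw [radius, Real.sqrt_le_left (by positivity), mul_pow, Real.sq_sqrt hc]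
      linarith
    have h6 := mul_le_mul_of_nonneg_left h5 hβ.le
    have h7 : 0 ≤ q.β₀ * √(c₀ q xs ls) := by positivity
    linarith

/-- Bound on the quantity of the termination test, relative to `ρ ^ s`. -/
def testConst (c ρ ε₀ : ℝ) : ℝ := 2 * ε₀ + 17 * c + 2 * c / (2 * ρ - 1)

/-- Constant term in the number of restart periods of a stage. -/
def periodsConst (c ρ η ε₀ : ℝ) : ℕ := ⌈2 * testConst c ρ ε₀ / (ε₀ * η)⌉₊ + 1

/-- Growth per stage of the number of restart periods. -/
def periodsSlope (ρ η : ℝ) : ℕ := ⌈ρ / η⌉₊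

theorem testBound_le_c₁ (hp : p.Admissible) (hq : q.Valid p) (hs : p.IsSaddle xs ls) (s : ℕ) :
    testBound p q s (run p q s).xPrev (run p q s).x (run p q s).lam (nextLam p q s)
      ≤ testConst (c₁ p q xs ls) q.ρ q.ε₀ * q.ρ ^ s := by
  refine (testBound_le hp hq hs s).trans ?_
  refine mul_le_mul_of_nonneg_right ?_ (pow_pos hq.ρ_pos s).le
  have h1 := c₁_ge p q xs ls
  have hc := c₀_nonneg q xs ls
  have hβ := hq.β₀_pos
  have hε := hq.ε₀_pos
  have h3 : 0 ≤ c₀ q xs ls * q.β₀ := by positivity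
  have h4 : 0 ≤ p.Lh ^ 2 * q.β₀ := by positivity
  have h5 : 0 < 2 * q.ρ - 1 := by linarith [hq.ρ_gt]
  have h6 : q.β₀ * (radius q xs ls ^ 2 / (2 * q.ρ - 1))
      ≤ 2 * c₁ p q xs ls / (2 * q.ρ - 1) := by
    rw [radius_sq, ← mul_div_assoc]
    refine div_le_div_of_nonneg_right ?_ h5.le
    linarith
  rw [testConst]
  have h7 := radius_sq q xs ls
  rw [mul_add, mul_add, h7]
  rw [h7] at h6
  linarith

/-- The required reduction grows like `(ρ / η)^s`, so the number of halvings is affine in `s`. The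
`+ 1` inside `periodsConst` keeps this number positive. -/
theorem run_m_succ_le (hp : p.Admissible) (hq : q.Valid p) (hs : p.IsSaddle xs ls) (s : ℕ) :
    (run p q (s + 1)).m ≤ p.N (q.β (s + 1))
      * (periodsConst (c₁ p q xs ls) q.ρ q.η q.ε₀ + periodsSlope q.ρ q.η * s) := by
  refine run_m_le hp hq (by unfold periodsConst; omega)
    ((testBound_le_c₁ hp hq hs s).trans ?_)
  have hη := hq.η_pos
  have hε := hq.ε₀_pos
  set B := testConst (c₁ p q xs ls) q.ρ q.ε₀
  -- The crude estimate `x ≤ ⌈x⌉ < 2 ^ ⌈x⌉` replaces a base-two logarithm, at the price of a larger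
  -- constant only.
  have h1 : 2 * B / (q.ε₀ * q.η) ≤ 2 ^ periodsConst (c₁ p q xs ls) q.ρ q.η q.ε₀ := by
    have h2 := Nat.le_ceil (2 * B / (q.ε₀ * q.η))
    have h3 : ⌈2 * B / (q.ε₀ * q.η)⌉₊ ≤ 2 ^ periodsConst (c₁ p q xs ls) q.ρ q.η q.ε₀ :=
      (Nat.le_succ _).trans Nat.lt_two_pow_self.le
    exact h2.trans (by exact_mod_cast h3)
  have h4 : q.ρ / q.η ≤ 2 ^ periodsSlope q.ρ q.η := by
    have h2 := Nat.le_ceil (q.ρ / q.η)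
    have h3 : ⌈q.ρ / q.η⌉₊ ≤ 2 ^ periodsSlope q.ρ q.η := Nat.lt_two_pow_self.le
    exact h2.trans (by exact_mod_cast h3)
  have h5 : (q.ρ / q.η) ^ s ≤ 2 ^ (periodsSlope q.ρ q.η * s) := by
    rw [pow_mul]
    exact pow_le_pow_left₀ (div_pos hq.ρ_pos hη).le h4 s
  have h6 : 2 * B / (q.ε₀ * q.η) * (q.ρ / q.η) ^ s
      ≤ 2 ^ periodsConst (c₁ p q xs ls) q.ρ q.η q.ε₀ * 2 ^ (periodsSlope q.ρ q.η * s) :=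
    mul_le_mul h1 h5 (pow_nonneg (div_pos hq.ρ_pos hη).le s) (by positivity)
  have h7 : B * q.ρ ^ s
      = 2 * B / (q.ε₀ * q.η) * (q.ρ / q.η) ^ s * (q.ε (s + 1) / 2) := by
    rw [Params.ε, div_pow, pow_succ]
    have := (pow_pos hη s).ne'
    field_simp
  rw [h7, pow_add]
  exact mul_le_mul_of_nonneg_right h6 (by have := hq.ε_pos (s + 1); positivity)

/-! ### Counting iterations -/

/-- The terms grow geometrically, so the last one dominates and the number of stages does not enter.
-/
theorem sum_inv_pow_le {r : ℝ} (h0 : 0 < r) (h1 : r < 1) (s : ℕ) :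
    ∑ t ∈ Finset.range s, (r ^ (t + 1))⁻¹ ≤ (r ^ s)⁻¹ / (1 - r) := by
  have h2 : 0 < 1 - r := by linarith
  rw [le_div_iff₀ h2]
  induction s with
  | zero => simp
  | succ s ih =>
    rw [Finset.sum_range_succ, add_mul]
    have h3 : (r ^ (s + 1))⁻¹ * r = (r ^ s)⁻¹ := by
      rw [pow_succ]; field_simp
    linarith

theorem sum_m_le (hp : p.Admissible) (hq : q.Valid p) (hs : p.IsSaddle xs ls) (s : ℕ) :
    ((∑ t ∈ Finset.range (s + 1), (run p q t).m : ℕ) : ℝ) ≤ q.m₀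
      + (periodsConst (c₁ p q xs ls) q.ρ q.η q.ε₀ + periodsSlope q.ρ q.η * s)
        * ∑ t ∈ Finset.range s, (p.N (q.β (t + 1)) : ℝ) := by
  rw [Finset.sum_range_succ']
  have h1 : ∑ t ∈ Finset.range s, (run p q (t + 1)).m ≤
      (periodsConst (c₁ p q xs ls) q.ρ q.η q.ε₀ + periodsSlope q.ρ q.η * s)
        * ∑ t ∈ Finset.range s, p.N (q.β (t + 1)) := by
    rw [Finset.mul_sum]
    refine Finset.sum_le_sum fun t ht => ?_
    rw [mul_comm]
    refine (run_m_succ_le hp hq hs t).trans (Nat.mul_le_mul_left _ ?_)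
    have := Finset.mem_range.1 ht
    gcongr
  have h2 : (run p q 0).m = q.m₀ := rfl
  rw [h2]
  have h3 : ((∑ t ∈ Finset.range s, (run p q (t + 1)).m : ℕ) : ℝ) ≤
      (periodsConst (c₁ p q xs ls) q.ρ q.η q.ε₀ + periodsSlope q.ρ q.η * s)
        * ∑ t ∈ Finset.range s, (p.N (q.β (t + 1)) : ℝ) := by exact_mod_cast h1
  push_cast at h3 ⊢
  linarith

theorem M_le (hp : p.Admissible) (hq : q.Valid p) (t : ℕ) :
    p.M (q.β t) ≤ √(p.L * q.β₀ + ‖p.A‖ ^ 2) ^ 2 / q.β t := by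
  have hL := hp.L_pos
  have hβ := hq.β_pos t
  have hβ₀ := hq.β₀_pos
  have h1 : q.β t ≤ q.β₀ :=
    mul_le_of_le_one_right hβ₀.le (pow_le_one₀ hq.ρ_pos.le hq.ρ_lt.le)
  rw [Real.sq_sqrt (by positivity), le_div_iff₀ hβ, Problem.M, add_mul, div_mul_cancel₀ _ hβ.ne']
  have := mul_le_mul_of_nonneg_left h1 hL.le
  linarith

/-- Length of a restart period given a bound on the condition number. -/
theorem N_le_of_le {t : ℕ} {R : ℝ} (hR : 0 ≤ R)
    (h : p.M (q.β t) / (p.μ + q.β t) ≤ R ^ 2) : (p.N (q.β t) : ℝ) ≤ 1 + 3 * R := by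
  have h1 : √(2 * p.M (q.β t) / (p.μ + q.β t)) ≤ 3 / 2 * R := by
    rw [Real.sqrt_le_left (by positivity), mul_div_assoc, mul_pow]
    nlinarith [sq_nonneg R]
  have h2 : (p.N (q.β t) : ℝ) < 2 * √(2 * p.M (q.β t) / (p.μ + q.β t)) + 1 :=
    Nat.ceil_lt_add_one (by positivity)
  linarith

/-- Only `μ + β_t ≥ β_t` is used, so the period grows like `1 / β_t`. -/
theorem N_le (hp : p.Admissible) (hq : q.Valid p) (t : ℕ) :
    (p.N (q.β t) : ℝ) ≤ 1 + 3 * (√(p.L * q.β₀ + ‖p.A‖ ^ 2) / q.β t) := by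
  have hβ := hq.β_pos t
  have hμ := hp.μ_nonneg
  refine N_le_of_le (by positivity) ?_
  have h1 := M_le hp hq t
  rw [div_le_iff₀ (by positivity), div_pow]
  refine h1.trans ?_
  rw [div_mul_eq_mul_div, div_le_div_iff₀ hβ (by positivity)]
  have : 0 ≤ √(p.L * q.β₀ + ‖p.A‖ ^ 2) ^ 2 := sq_nonneg _
  have h3 : √(p.L * q.β₀ + ‖p.A‖ ^ 2) ^ 2 * q.β t ^ 2
      ≤ √(p.L * q.β₀ + ‖p.A‖ ^ 2) ^ 2 * ((p.μ + q.β t) * q.β t) := by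
    refine mul_le_mul_of_nonneg_left ?_ this
    nlinarith
  linarith

/-- Here `μ + β_t ≥ μ` is used instead, so that `β_t` enters through its square root. -/
theorem N_le_of_pos (hp : p.Admissible) (hq : q.Valid p) (hμ : 0 < p.μ) (t : ℕ) :
    (p.N (q.β t) : ℝ)
      ≤ 1 + 3 * (√(p.L * q.β₀ + ‖p.A‖ ^ 2) / (√p.μ * √q.β₀ * √q.ρ ^ t)) := by
  have hβ := hq.β_pos t
  have hβ₀ := hq.β₀_pos
  have hρ := hq.ρ_pos
  refine N_le_of_le (by positivity) ?_
  have h1 := M_le hp hq t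
  have h2 : (√p.μ * √q.β₀ * √q.ρ ^ t) ^ 2 = p.μ * q.β t := by
    rw [mul_pow, mul_pow, ← pow_mul, mul_comm t 2, pow_mul, Real.sq_sqrt hμ.le,
      Real.sq_sqrt hβ₀.le, Real.sq_sqrt hρ.le, Params.β, mul_assoc]
  rw [div_pow, h2]
  have h3 : 0 ≤ √(p.L * q.β₀ + ‖p.A‖ ^ 2) ^ 2 := sq_nonneg _
  calc p.M (q.β t) / (p.μ + q.β t)
      ≤ (√(p.L * q.β₀ + ‖p.A‖ ^ 2) ^ 2 / q.β t) / (p.μ + q.β t) := by gcongr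
    _ ≤ (√(p.L * q.β₀ + ‖p.A‖ ^ 2) ^ 2 / q.β t) / p.μ := by
        gcongr
        linarith
    _ = √(p.L * q.β₀ + ‖p.A‖ ^ 2) ^ 2 / (p.μ * q.β t) := by
        rw [div_div, mul_comm p.μ]

/-- The first stage at which a geometric bound drops below the tolerance. -/
theorem exists_stage {ρ K ε : ℝ} (hρ0 : 0 < ρ) (hρ1 : ρ < 1) (hε : 0 < ε) (hK : ε ≤ K) :
    ∃ s : ℕ, K * ρ ^ s ≤ ε ∧ ε * ρ ≤ K * ρ ^ s := by
  classical
  have hKpos : 0 < K := hε.trans_le hK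
  have hex : ∃ s : ℕ, K * ρ ^ s ≤ ε := by
    obtain ⟨s, hs⟩ := exists_pow_lt_of_lt_one (div_pos hε hKpos) hρ1
    rw [lt_div_iff₀ hKpos] at hs
    exact ⟨s, by linarith⟩
  refine ⟨Nat.find hex, Nat.find_spec hex, ?_⟩
  cases h : Nat.find hex with
  | zero =>
    rw [pow_zero, mul_one]
    nlinarith
  | succ k =>
    have h1 := not_le.1 (Nat.find_min hex (m := k) (by omega))
    rw [pow_succ, ← mul_assoc]
    exact mul_le_mul_of_nonneg_right h1.le hρ0.le

/-- The stage index is at most logarithmic in the accuracy. -/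
theorem stage_le {ρ c ε : ℝ} {s : ℕ} (hρ0 : 0 < ρ) (hρ1 : ρ < 1) (hε : 0 < ε) (hc : ε ≤ c)
    (h : ε * ρ ≤ 7 * c * ρ ^ s) :
    (s : ℝ) ≤ (1 + 2 / Real.log ρ⁻¹) / Real.log ρ⁻¹ * Real.log (c / (ε * ρ)) := by
  have hcpos : 0 < c := hε.trans_le hc
  have ha : 0 < Real.log ρ⁻¹ := Real.log_pos ((one_lt_inv₀ hρ0).2 hρ1)
  set a := Real.log ρ⁻¹ with ha'
  have hl : a ≤ Real.log (c / (ε * ρ)) := by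
    refine Real.log_le_log (inv_pos.2 hρ0) ?_
    rw [le_div_iff₀ (by positivity), mul_comm ε, ← mul_assoc, inv_mul_cancel₀ hρ0.ne', one_mul]
    exact hc
  set l := Real.log (c / (ε * ρ))
  have h1 : (ρ⁻¹) ^ s ≤ 7 * (c / (ε * ρ)) := by
    rw [inv_pow, ← mul_div_assoc, le_div_iff₀ (by positivity), inv_mul_le_iff₀ (by positivity)]
    linarith
  have h2 := Real.log_le_log (pow_pos (inv_pos.2 hρ0) s) h1
  rw [Real.log_pow, Real.log_mul (by norm_num) (by positivity)] at h2
  -- The factor 7 costs an additive constant, absorbed by `l` because `l ≥ a` when `ε ≤ c`.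
  have h7 : Real.log 7 ≤ 2 := by
    rw [Real.log_le_iff_le_exp (by norm_num)]
    have h8 := Real.exp_one_gt_d9
    have h9 : Real.exp 2 = Real.exp 1 * Real.exp 1 := by rw [← Real.exp_add]; norm_num
    rw [h9]
    nlinarith
  have h3 : 2 ≤ 2 / a * l := by
    rw [div_mul_eq_mul_div, le_div_iff₀ ha]
    linarith
  rw [div_mul_eq_mul_div, le_div_iff₀ ha, add_mul, one_mul]
  change (s : ℝ) * a ≤ Real.log 7 + l at h2
  linarith

/-! ### The complexity bounds -/

/-- Ratio of the number of stages to the logarithmic factor. -/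
def stageConst (ρ : ℝ) : ℝ := (1 + 2 / Real.log ρ⁻¹) / Real.log ρ⁻¹

/-- Ratio of the number of restart periods of a stage to the logarithmic factor. -/
def roundConst (c ρ η ε₀ : ℝ) : ℝ :=
  periodsConst c ρ η ε₀ / Real.log ρ⁻¹ + periodsSlope ρ η * stageConst ρ

/-- Constant of the complexity bound in the convex case. -/
def convexConst (c ρ η β₀ ε₀ : ℝ) (m₀ : ℕ) : ℝ :=
  m₀ / Real.log ρ⁻¹ ^ 2
    + roundConst c ρ η ε₀ * (stageConst ρ + 21 * c / (β₀ * (1 - ρ) * ρ) / Real.log ρ⁻¹)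

/-- Constant of the complexity bound in the strongly convex case. -/
def strongConst (c ρ η β₀ ε₀ : ℝ) (m₀ : ℕ) : ℝ :=
  m₀ * √ε₀ / Real.log ρ⁻¹
    + roundConst c ρ η ε₀ * (√(7 * c / ρ) / (1 - √ρ) * (1 + 3 / √β₀))

variable {ε : ℝ} {s : ℕ}

theorem log_pos_of_valid (hq : q.Valid p) : 0 < Real.log q.ρ⁻¹ :=
  Real.log_pos ((one_lt_inv₀ hq.ρ_pos).2 hq.ρ_lt)

/-- The logarithmic factor is bounded below by a positive number depending on `ρ` alone, which lets
additive constants be absorbed into multiples of it. -/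
theorem log_le (hq : q.Valid p) (hε : 0 < ε) (hε₀ : ε ≤ q.ε₀) :
    Real.log q.ρ⁻¹ ≤ Real.log (c₁ p q xs ls / (ε * q.ρ)) := by
  have hρ := hq.ρ_pos
  refine Real.log_le_log (inv_pos.2 hρ) ?_
  rw [le_div_iff₀ (by positivity), mul_comm ε, ← mul_assoc, inv_mul_cancel₀ hρ.ne', one_mul]
  exact hε₀.trans (ε₀_le_c₁ hq)

theorem stageConst_pos (hq : q.Valid p) : 0 < stageConst q.ρ := by
  have := log_pos_of_valid hq
  unfold stageConst; positivity

theorem roundConst_nonneg (hq : q.Valid p) (c : ℝ) : 0 ≤ roundConst c q.ρ q.η q.ε₀ := by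
  have := log_pos_of_valid hq
  have := stageConst_pos hq
  unfold roundConst; positivity

theorem convexConst_nonneg (hq : q.Valid p) :
    0 ≤ convexConst (c₁ p q xs ls) q.ρ q.η q.β₀ q.ε₀ q.m₀ := by
  have h1 := log_pos_of_valid hq
  have h2 := stageConst_pos hq
  have h3 := roundConst_nonneg hq (c₁ p q xs ls)
  have h4 := hq.β₀_pos
  have h5 := hq.ρ_pos
  have h6 : 0 < 1 - q.ρ := by linarith [hq.ρ_lt]
  have h7 : 0 < c₁ p q xs ls := hq.ε₀_pos.trans_le (ε₀_le_c₁ hq)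
  unfold convexConst; positivity

theorem sqrt_ρ_lt_one (hq : q.Valid p) : √q.ρ < 1 := by
  rw [Real.sqrt_lt' one_pos, one_pow]
  exact hq.ρ_lt

theorem strongConst_nonneg (hq : q.Valid p) :
    0 ≤ strongConst (c₁ p q xs ls) q.ρ q.η q.β₀ q.ε₀ q.m₀ := by
  have h1 := log_pos_of_valid hq
  have h3 := roundConst_nonneg hq (c₁ p q xs ls)
  have h6 : 0 < 1 - √q.ρ := by linarith [sqrt_ρ_lt_one hq]
  unfold strongConst; positivity

/-- Restart periods per stage in terms of the logarithmic factor. -/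
theorem periods_le (hq : q.Valid p) (hε : 0 < ε) (hε₀ : ε ≤ q.ε₀)
    (hs : ε * q.ρ ≤ 7 * c₁ p q xs ls * q.ρ ^ s) :
    (periodsConst (c₁ p q xs ls) q.ρ q.η q.ε₀ + periodsSlope q.ρ q.η * s : ℝ)
      ≤ roundConst (c₁ p q xs ls) q.ρ q.η q.ε₀ * Real.log (c₁ p q xs ls / (ε * q.ρ)) := by
  have ha := log_pos_of_valid hq
  have hl := log_le (xs := xs) (ls := ls) hq hε hε₀
  have h1 := stage_le hq.ρ_pos hq.ρ_lt hε (hε₀.trans (ε₀_le_c₁ hq)) hs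
  change (s : ℝ) ≤ stageConst q.ρ * _ at h1
  set l := Real.log (c₁ p q xs ls / (ε * q.ρ))
  have h2 : (periodsSlope q.ρ q.η : ℝ) * s ≤ periodsSlope q.ρ q.η * (stageConst q.ρ * l) := by
    gcongr
  have h3 : (periodsConst (c₁ p q xs ls) q.ρ q.η q.ε₀ : ℝ)
      ≤ periodsConst (c₁ p q xs ls) q.ρ q.η q.ε₀ / Real.log q.ρ⁻¹ * l := by
    rw [div_mul_eq_mul_div, le_div_iff₀ ha]
    gcongr
  rw [roundConst, add_mul]
  linarith

theorem inv_pow_le (hq : q.Valid p) (hε : 0 < ε)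
    (hs : ε * q.ρ ≤ 7 * c₁ p q xs ls * q.ρ ^ s) :
    (q.ρ ^ s)⁻¹ ≤ 7 * c₁ p q xs ls / (ε * q.ρ) := by
  have hρ := hq.ρ_pos
  rw [le_div_iff₀ (by positivity), inv_mul_le_iff₀ (by positivity)]
  linarith

/-- The period lengths sum to the number of stages plus a multiple of `S / ε`, both at most a
constant times `X l`; the periods per stage contribute the other factor `l`. -/
theorem sum_m_le_convex (hp : p.Admissible) (hq : q.Valid p) (hsad : p.IsSaddle xs ls)
    (hε : 0 < ε) (hε₀ : ε ≤ q.ε₀) (hs : ε * q.ρ ≤ 7 * c₁ p q xs ls * q.ρ ^ s) :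
    ((∑ t ∈ Finset.range (s + 1), (run p q t).m : ℕ) : ℝ)
      ≤ convexConst (c₁ p q xs ls) q.ρ q.η q.β₀ q.ε₀ q.m₀
        * max 1 (√(p.L * q.β₀ + ‖p.A‖ ^ 2) / ε)
        * Real.log (c₁ p q xs ls / (ε * q.ρ)) ^ 2 := by
  have ha := log_pos_of_valid hq
  have hl := log_le (xs := xs) (ls := ls) hq hε hε₀
  have h1 := stage_le hq.ρ_pos hq.ρ_lt hε (hε₀.trans (ε₀_le_c₁ hq)) hs
  change (s : ℝ) ≤ stageConst q.ρ * _ at h1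
  have h2 := periods_le hq hε hε₀ hs
  have h3 := sum_m_le hp hq hsad s
  have h4 := inv_pow_le hq hε hs
  have hκ := roundConst_nonneg hq (c₁ p q xs ls)
  have hcs := stageConst_pos hq
  have hc : 0 < c₁ p q xs ls := hq.ε₀_pos.trans_le (ε₀_le_c₁ hq)
  have hρ := hq.ρ_pos
  have hβ := hq.β₀_pos
  have h1ρ : 0 < 1 - q.ρ := by linarith [hq.ρ_lt]
  set l := Real.log (c₁ p q xs ls / (ε * q.ρ))
  set a := Real.log q.ρ⁻¹
  set S := √(p.L * q.β₀ + ‖p.A‖ ^ 2)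
  set κ := roundConst (c₁ p q xs ls) q.ρ q.η q.ε₀
  set X := max 1 (S / ε)
  set Q := 21 * c₁ p q xs ls / (q.β₀ * (1 - q.ρ) * q.ρ) with hQ
  have hX1 : 1 ≤ X := le_max_left _ _
  have hX2 : S / ε ≤ X := le_max_right _ _
  have hS : 0 ≤ S := Real.sqrt_nonneg _
  have hQ0 : 0 ≤ Q := by positivity
  have hl0 : 0 < l := ha.trans_le hl
  have hla : 1 ≤ l / a := (one_le_div ha).2 hl
  have hN : ∑ t ∈ Finset.range s, (p.N (q.β (t + 1)) : ℝ) ≤ (stageConst q.ρ + Q / a) * X * l := by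
    calc ∑ t ∈ Finset.range s, (p.N (q.β (t + 1)) : ℝ)
        ≤ ∑ t ∈ Finset.range s, (1 + 3 * S / q.β₀ * (q.ρ ^ (t + 1))⁻¹) := by
          refine Finset.sum_le_sum fun t _ => (N_le hp hq (t + 1)).trans (le_of_eq ?_)
          simp only [Params.β, S]
          field_simp
      _ = s + 3 * S / q.β₀ * ∑ t ∈ Finset.range s, (q.ρ ^ (t + 1))⁻¹ := by
          rw [Finset.sum_add_distrib, ← Finset.mul_sum]; simp
      _ ≤ s + 3 * S / q.β₀ * ((7 * c₁ p q xs ls / (ε * q.ρ)) / (1 - q.ρ)) := by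
          gcongr
          exact (sum_inv_pow_le hρ hq.ρ_lt s).trans (div_le_div_of_nonneg_right h4 h1ρ.le)
      _ = s + Q * (S / ε) := by
          rw [hQ]; field_simp; ring
      _ ≤ stageConst q.ρ * l * X + Q * X * (l / a) := by
          have t1 : stageConst q.ρ * l ≤ stageConst q.ρ * l * X :=
            le_mul_of_one_le_right (by positivity) hX1
          have t2 : Q * (S / ε) ≤ Q * X := mul_le_mul_of_nonneg_left hX2 hQ0
          have t3 : Q * X ≤ Q * X * (l / a) := le_mul_of_one_le_right (by positivity) hla
          linarith
      _ = (stageConst q.ρ + Q / a) * X * l := by ring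
  have hN0 : 0 ≤ ∑ t ∈ Finset.range s, (p.N (q.β (t + 1)) : ℝ) :=
    Finset.sum_nonneg fun _ _ => Nat.cast_nonneg _
  have h5 := mul_le_mul h2 hN hN0 (by positivity)
  have h6 : (q.m₀ : ℝ) ≤ q.m₀ / a ^ 2 * X * l ^ 2 := by
    have t1 : (1 : ℝ) ≤ (l / a) ^ 2 := one_le_pow₀ hla
    have t2 : (1 : ℝ) ≤ X * (l / a) ^ 2 := by nlinarith
    calc (q.m₀ : ℝ) ≤ q.m₀ * (X * (l / a) ^ 2) := le_mul_of_one_le_right (by positivity) t2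
      _ = q.m₀ / a ^ 2 * X * l ^ 2 := by rw [div_pow]; ring
  refine h3.trans ((add_le_add h6 h5).trans (le_of_eq ?_))
  rw [convexConst]
  ring

/-- The additive 1 in each period length is put inside the geometric sum instead of being counted
per stage. This saves a logarithm and is the source of `√μ` in the numerator, since `√μ / √(μ ε) = 1
/ √ε`. -/
theorem sum_m_le_strong (hp : p.Admissible) (hq : q.Valid p) (hsad : p.IsSaddle xs ls)
    (hμ : 0 < p.μ) (hε : 0 < ε) (hε₀ : ε ≤ q.ε₀)
    (hs : ε * q.ρ ≤ 7 * c₁ p q xs ls * q.ρ ^ s) :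
    ((∑ t ∈ Finset.range (s + 1), (run p q t).m : ℕ) : ℝ)
      ≤ strongConst (c₁ p q xs ls) q.ρ q.η q.β₀ q.ε₀ q.m₀
        * ((√(p.L * q.β₀ + ‖p.A‖ ^ 2) + √p.μ) / √(p.μ * ε))
        * Real.log (c₁ p q xs ls / (ε * q.ρ)) := by
  have ha := log_pos_of_valid hq
  have hl := log_le (xs := xs) (ls := ls) hq hε hε₀
  have h2 := periods_le hq hε hε₀ hs
  have h3 := sum_m_le hp hq hsad s
  have h4 := inv_pow_le hq hε hs
  have hκ := roundConst_nonneg hq (c₁ p q xs ls)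
  have hc : 0 < c₁ p q xs ls := hq.ε₀_pos.trans_le (ε₀_le_c₁ hq)
  have hρ := hq.ρ_pos
  have hβ := hq.β₀_pos
  have hr0 : 0 < √q.ρ := Real.sqrt_pos.2 hρ
  have hr1 : 0 < 1 - √q.ρ := by linarith [sqrt_ρ_lt_one hq]
  set l := Real.log (c₁ p q xs ls / (ε * q.ρ))
  set a := Real.log q.ρ⁻¹
  set S := √(p.L * q.β₀ + ‖p.A‖ ^ 2)
  set κ := roundConst (c₁ p q xs ls) q.ρ q.η q.ε₀
  set W := (S + √p.μ) / √(p.μ * ε) with hW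
  have hS : 0 ≤ S := Real.sqrt_nonneg _
  have hl0 : 0 < l := ha.trans_le hl
  have hla : 1 ≤ l / a := (one_le_div ha).2 hl
  have hmu : 0 < √p.μ := Real.sqrt_pos.2 hμ
  have hse : 0 < √ε := Real.sqrt_pos.2 hε
  have hsb : 0 < √q.β₀ := Real.sqrt_pos.2 hβ
  have hsplit : √(p.μ * ε) = √p.μ * √ε := Real.sqrt_mul hμ.le ε
  have hW0 : 0 ≤ W := by positivity
  have hWlow : 1 / √ε ≤ W := by
    rw [hW, hsplit, div_le_div_iff₀ hse (by positivity)]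
    nlinarith [mul_nonneg hS hse.le]
  have hpow : (√q.ρ ^ s)⁻¹ ≤ √(7 * c₁ p q xs ls / q.ρ) / √ε := by
    have e1 : (√q.ρ ^ s)⁻¹ = √((q.ρ ^ s)⁻¹) := by
      rw [Real.sqrt_inv, sqrt_pow_eq hρ.le]
    have e2 : 7 * c₁ p q xs ls / q.ρ / ε = 7 * c₁ p q xs ls / (ε * q.ρ) := by
      rw [div_div, mul_comm q.ρ]
    rw [e1, ← Real.sqrt_div' _ hε.le, e2]
    exact Real.sqrt_le_sqrt h4
  have hfac : (1 + 3 * S / (√p.μ * √q.β₀)) / √ε ≤ (1 + 3 / √q.β₀) * W := by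
    have e1 : (1 + 3 * S / (√p.μ * √q.β₀)) / √ε
        = (√p.μ + 3 / √q.β₀ * S) / (√p.μ * √ε) := by
      field_simp
    have e2 : (1 + 3 / √q.β₀) * W
        = ((1 + 3 / √q.β₀) * (S + √p.μ)) / (√p.μ * √ε) := by
      rw [hW, hsplit, mul_div_assoc]
    rw [e1, e2]
    refine div_le_div_of_nonneg_right ?_ (by positivity)
    have t1 : 0 ≤ 3 / √q.β₀ * √p.μ := by positivity
    linarith
  have hN : ∑ t ∈ Finset.range s, (p.N (q.β (t + 1)) : ℝ)
      ≤ √(7 * c₁ p q xs ls / q.ρ) / (1 - √q.ρ) * (1 + 3 / √q.β₀) * W := by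
    calc ∑ t ∈ Finset.range s, (p.N (q.β (t + 1)) : ℝ)
        ≤ ∑ t ∈ Finset.range s, (1 + 3 * S / (√p.μ * √q.β₀)) * (√q.ρ ^ (t + 1))⁻¹ := by
          refine Finset.sum_le_sum fun t _ => (N_le_of_pos hp hq hμ (t + 1)).trans ?_
          have t1 : 1 ≤ (√q.ρ ^ (t + 1))⁻¹ :=
            (one_le_inv₀ (by positivity)).2
              (pow_le_one₀ hr0.le (by linarith))
          have e1 : 3 * (S / (√p.μ * √q.β₀ * √q.ρ ^ (t + 1)))
              = 3 * S / (√p.μ * √q.β₀) * (√q.ρ ^ (t + 1))⁻¹ := by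
            field_simp
          rw [add_mul, one_mul, e1]
          linarith
      _ = (1 + 3 * S / (√p.μ * √q.β₀)) * ∑ t ∈ Finset.range s, (√q.ρ ^ (t + 1))⁻¹ := by
          rw [← Finset.mul_sum]
      _ ≤ (1 + 3 * S / (√p.μ * √q.β₀))
          * ((√(7 * c₁ p q xs ls / q.ρ) / √ε) / (1 - √q.ρ)) := by
          gcongr
          exact (sum_inv_pow_le hr0 (sqrt_ρ_lt_one hq) s).trans
            (div_le_div_of_nonneg_right hpow hr1.le)
      _ = √(7 * c₁ p q xs ls / q.ρ) / (1 - √q.ρ)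
          * ((1 + 3 * S / (√p.μ * √q.β₀)) / √ε) := by ring
      _ ≤ √(7 * c₁ p q xs ls / q.ρ) / (1 - √q.ρ) * ((1 + 3 / √q.β₀) * W) := by gcongr
      _ = √(7 * c₁ p q xs ls / q.ρ) / (1 - √q.ρ) * (1 + 3 / √q.β₀) * W := by ring
  have hN0 : 0 ≤ ∑ t ∈ Finset.range s, (p.N (q.β (t + 1)) : ℝ) :=
    Finset.sum_nonneg fun _ _ => Nat.cast_nonneg _
  have h5 := mul_le_mul h2 hN hN0 (by positivity)
  have h6 : (q.m₀ : ℝ) ≤ q.m₀ * √q.ε₀ / a * W * l := by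
    have t1 : 1 ≤ √q.ε₀ * W := by
      have t2 : √ε ≤ √q.ε₀ := Real.sqrt_le_sqrt hε₀
      calc (1 : ℝ) = √ε * (1 / √ε) := by field_simp
        _ ≤ √q.ε₀ * W := by gcongr
    have t3 : 1 ≤ √q.ε₀ * W * (l / a) := by nlinarith
    calc (q.m₀ : ℝ) ≤ q.m₀ * (√q.ε₀ * W * (l / a)) :=
          le_mul_of_one_le_right (by positivity) t3
      _ = q.m₀ * √q.ε₀ / a * W * l := by ring
  refine h3.trans ((add_le_add h6 h5).trans (le_of_eq ?_))
  rw [strongConst]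
  ring

end IPALM
end

/-! ### Choice of the final stage and conclusion -/

theorem corollary4p1 :
    -- `C` is the constant hidden in the `Õ`, a function of `c₁, c₂, ρ, η, β₀, ε₀, m₀` only
    ∃ C : ℝ → ℝ → ℝ → ℝ → ℝ → ℝ → ℕ → ℝ,
      ∀ (n d₁ d₂ : ℕ) (p : IPALM.Problem n d₁ d₂) (q : IPALM.Params n d₁ d₂)
        (xs : IPALM.Primal n) (ls : IPALM.Dual d₁ d₂),
        p.Admissible → q.Valid p → p.IsOptimalPair xs ls →
        ∀ ε : ℝ, 0 < ε → ε ≤ q.ε₀ →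
          ∃ s : ℕ, p.IsEpsSolution ε (IPALM.run p q s).x ∧
            (0 < p.μ →
              ((∑ t ∈ Finset.range (s + 1), (IPALM.run p q t).m : ℕ) : ℝ) ≤
                C (IPALM.c₁ p q xs ls) (IPALM.c₂ p q xs ls) q.ρ q.η q.β₀ q.ε₀ q.m₀
                  * ((√(p.L * q.β₀ + ‖p.A‖ ^ 2) + √p.μ) / √(p.μ * ε))
                  * Real.log (IPALM.c₁ p q xs ls / (ε * q.ρ))) ∧
            (p.μ = 0 →
              ((∑ t ∈ Finset.range (s + 1), (IPALM.run p q t).m : ℕ) : ℝ) ≤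
                C (IPALM.c₁ p q xs ls) (IPALM.c₂ p q xs ls) q.ρ q.η q.β₀ q.ε₀ q.m₀
                  * max 1 (√(p.L * q.β₀ + ‖p.A‖ ^ 2) / ε)
                  * Real.log (IPALM.c₁ p q xs ls / (ε * q.ρ)) ^ 2) := by
  -- Both constants are nonnegative, so their sum serves both regimes.
  refine ⟨fun c _ ρ η β₀ ε₀ m₀ => IPALM.convexConst c ρ η β₀ ε₀ m₀
    + IPALM.strongConst c ρ η β₀ ε₀ m₀, ?_⟩
  intro n d₁ d₂ p q xs ls hp hq hopt ε hε hε₀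
  have hsad := hopt.isSaddle hp
  have hle : ε ≤ IPALM.c₁ p q xs ls := hε₀.trans (IPALM.ε₀_le_c₁ hq)
  obtain ⟨s, hs1, hs2⟩ := IPALM.exists_stage hq.ρ_pos hq.ρ_lt hε
    (K := 7 * IPALM.c₁ p q xs ls) (by linarith)
  have h1 := IPALM.convexConst_nonneg (xs := xs) (ls := ls) hq
  have h2 := IPALM.strongConst_nonneg (xs := xs) (ls := ls) hq
  have h3 : 0 ≤ Real.log (IPALM.c₁ p q xs ls / (ε * q.ρ)) :=
    (IPALM.log_pos_of_valid hq).le.trans (IPALM.log_le hq hε hε₀)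
  refine ⟨s, IPALM.isEpsSolution_of_c₁ hp hq hsad hs1, fun hμ => ?_, fun _ => ?_⟩
  · refine (IPALM.sum_m_le_strong hp hq hsad hμ hε hε₀ hs2).trans ?_
    gcongr
    linarith
  · refine (IPALM.sum_m_le_convex hp hq hsad hε hε₀ hs2).trans ?_
    gcongr
    linarith
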